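/- **Extended constraint HKR map.** Let $0\le n_0\le n_N\le n_T$ be integers. Write $C=\mathbb{R}^{n_N}\subseteq\mathbb{R}^{n_T}$ for the subspace on which all but the first $n_N$ coordinates vanish, and let $\mathbb{R}^{n_0}$ be the distribution on $C$ spanned by $\partial_1,\dots,\partial_{n_0}$ (with $\partial_i=\partial/\partial x^i$). Together these form the constraint manifold $\mathbb{R}^n=(\mathbb{R}^{n_T},\mathbb{R}^{n_N},\mathbb{R}^{n_0})$. *Constraint modules.* A constraint $\mathbb{R}$-module is a triple $E=(E_T,E_N,E_0)$ of real vector spaces with $E_0\subseteq E_N$, together with a linear map $\iota\colon E_N\to E_T$. A morphism $E\to F$ is a pair of linear maps $\Phi_T\colon E_T\to F_T$, $\Phi_N\colon E_N\to F_N$ with $\Phi_T\iota=\iota\Phi_N$ and $\Phi_N(E_0)\subseteq F_0$. A regular monomorphism is an equalizer in this category; equivalently, $\Phi_T$ and $\Phi_N$ are injective and $\Phi_N^{-1}(F_0)=E_0$. *Functions and cochains.* Let $A_T=C^\infty(\mathbb{R}^{n_T})$, $A_N=\{f\in A_T : \partial_i f|_C=0 \text{ for all } i\le n_0\}$ and $A_0=\{f\in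 A_T : f|_C=0\}$. Let $\mathrm{C}^k_{\mathrm{diff},T}$ be the space of $k$-differential operators $\varphi\colon A_T^k\to A_T$ with smooth coefficients. Let $\mathrm{C}^k_{\mathrm{diff},N}$ consist of those $\varphi$ which map $A_N^k$ into $A_N$, and which map a tuple in $A_N^k$ with at least one entry in $A_0$ into $A_0$. Let $\mathrm{C}^k_{\mathrm{diff},0}\subseteq \mathrm{C}^k_{\mathrm{diff},N}$ consist of those which map $A_N^k$ into $A_0$. With the Hochschild differential $\delta$, the constraint module $\mathrm{HH}^2_{\mathrm{diff}}(C^\infty(\mathbb{R}^n))$ has as $T$- and $N$-components the $2$-cocycles modulo the $2$-coboundaries of the respective component. Its $0$-component is the set of classes in the $N$-component of cocycles in $\mathrm{C}^2_{\mathrm{diff},0}$, and $\iota$ sends the class of a cocycle to its class in the $T$-component. *Extended bivector fields.* Let $V_T=\Gamma^\infty(T\mathbb{R}^{n_T})$. Let $V_N$ be the set of $X=\sum_i X^i\partial_i$ with $X^i\in A_0$ for $i>n_N$ and $X^i\in A_N$ for $n_0<i\le n_N$. Let $V_0$ be the set of $X$ with $X^i\in A_0$ for $i>n_0$. Put $\mathfrak{X}^2_T=\Lambda^2_{A_T}V_T$,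 $\mathfrak{X}^2_N=V_N\wedge V_N+V_0\wedge V_T$ and $\mathfrak{X}^2_0=V_0\wedge V_T$ (linear spans). Let $$S=\bigoplus_{k\ge1}\mathrm{Sym}^k\,\Gamma^\infty\big(T\mathbb{R}^{n_0}|_C\big)\vee\Gamma^\infty\big(T\mathbb{R}^{n_T-n_N}|_C\big),$$ the $C^\infty(C)$-linear span of the symmetric tensors $\partial_{i_1}\vee\dots\vee\partial_{i_k}\vee\partial_j$ with $k\ge1$, $i_1,\dots,i_k\le n_0$ and $j>n_N$. The constraint module $\mathfrak{X}^2_{\mathrm{ext}}(\mathbb{R}^n)$ has components $\mathfrak{X}^2_T$, $\mathfrak{X}^2_N\oplus S$ and $\mathfrak{X}^2_0\oplus S$, with $\iota(X,D)=X$. *The maps.* Let $\mathcal{U}(X)(f,g)=\tfrac12 X(\mathrm{d}f,\mathrm{d}g)$. Let $\mathrm{prol}$ extend the coefficient functions of $D$ from $C$ to $\mathbb{R}^{n_T}$ constantly in the coordinates $x^{n_N+1},\dots,x^{n_T}$. Let $\mathrm{Op}$ be the $A_T$-linear map from symmetric tensor fields to differential operators with $\mathrm{Op}(\partial_{i_1}\vee\dots\vee\partial_{i_r})=\partial_{i_1}\cdots\partial_{i_r}$.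 **Claim.** The formulas $$(\mathcal{U}_{\mathrm{ext}})_T(X)=[\mathcal{U}(X)],\qquad (\mathcal{U}_{\mathrm{ext}})_N(X,D)=\big[\mathcal{U}(X)+\delta\big(\mathrm{Op}(\mathrm{prol}(D))\big)\big]$$ are well defined (the representatives are cocycles in the $T$-component and in the $N$-component, respectively). They define a morphism of constraint $\mathbb{R}$-modules $\mathcal{U}_{\mathrm{ext}}\colon\mathfrak{X}^2_{\mathrm{ext}}(\mathbb{R}^n)\to\mathrm{HH}^2_{\mathrm{diff}}(C^\infty(\mathbb{R}^n))$, and this morphism is a regular monomorphism. -/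

import Mathlib

open CategoryTheory
open scoped ContDiff

noncomputable section

/-! ### Constraint modules -/

/-- A constraint module `(E_T, E_N, E_0)` over `R`: modules `E_T` and `E_N`, a submodule
`E_0 ⊆ E_N`, and a (not necessarily injective) linear map `ι : E_N → E_T`. -/
structure ConModule (R : Type) [CommRing R] where
  T : Type
  N : Type
  [addCommGroupT : AddCommGroup T]
  [moduleT : Module R T]
  [addCommGroupN : AddCommGroup N]
  [moduleN : Module R N]
  ι : N →ₗ[R] T
  zero : Submodule R N

namespace ConModule

attribute [instance] addCommGroupT moduleT addCommGroupN moduleN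

variable {R : Type} [CommRing R]

/-- A morphism of constraint modules: a pair of linear maps compatible with `ι` whose
`N`-component maps the `0`-component into the `0`-component. -/
@[ext]
structure Hom (E F : ConModule R) where
  T : E.T →ₗ[R] F.T
  N : E.N →ₗ[R] F.N
  comm : ∀ x, T (E.ι x) = F.ι (N x)
  map_zero_comp : ∀ x ∈ E.zero, N x ∈ F.zero

/-- The category of constraint modules over `R`. -/
instance : Category (ConModule R) where
  Hom := Hom
  id E := ⟨LinearMap.id, LinearMap.id, fun _ => rfl, fun _ h => h⟩
  comp f g := ⟨g.T ∘ₗ f.T, g.N ∘ₗ f.N,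
    fun x => by simp [f.comm, g.comm],
    fun x h => g.map_zero_comp _ (f.map_zero_comp x h)⟩

section Subquotient

variable {V : Type} [AddCommGroup V] [Module R V] (ZT ZN Z0 BT BN : Submodule R V)
  (hZ : ZN ≤ ZT) (hB : BN ≤ BT)

/-- The cohomology of a constraint complex whose `T`-, `N`- and `0`-components in the relevant
degree are submodules of `V`, with cocycles `Z0 ≤ ZN ≤ ZT` and coboundaries `BN ≤ BT`: the `T`-
and `N`-components are cocycles modulo coboundaries of the respective component, the
`0`-component consists of the classes in the `N`-component of cocycles in `Z0`. -/
def subquotient : ConModule R where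
  T := ZT ⧸ BT.submoduleOf ZT
  N := ZN ⧸ BN.submoduleOf ZN
  ι := Submodule.mapQ _ _ (Submodule.inclusion hZ) fun _ hx => hB hx
  zero := (Z0.submoduleOf ZN).map (BN.submoduleOf ZN).mkQ

/-- The class of a cocycle in the `T`-component. -/
def subquotient.mkT : ZT →ₗ[R] (subquotient ZT ZN Z0 BT BN hZ hB).T := (BT.submoduleOf ZT).mkQ

/-- The class of a cocycle in the `N`-component. -/
def subquotient.mkN : ZN →ₗ[R] (subquotient ZT ZN Z0 BT BN hZ hB).N := (BN.submoduleOf ZN).mkQ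

end Subquotient

end ConModule

/-! ### Smooth functions and the constraint manifold `ℝⁿ` -/

/-- The smooth functions `ℝ^m → ℝ` as a subalgebra of all functions. -/
def smoothSubalgebra (m : ℕ) : Subalgebra ℝ ((Fin m → ℝ) → ℝ) where
  carrier := {f | ContDiff ℝ ∞ f}
  mul_mem' {f g} (hf : ContDiff ℝ ∞ f) (hg : ContDiff ℝ ∞ g) := hf.mul hg
  add_mem' {f g} (hf : ContDiff ℝ ∞ f) (hg : ContDiff ℝ ∞ g) := hf.add hg
  algebraMap_mem' r := (contDiff_const : ContDiff ℝ ∞ fun _ : Fin m → ℝ => r)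

/-- The real algebra `C^∞(ℝ^m)`. -/
def SmoothFun (m : ℕ) : Type := smoothSubalgebra m

namespace SmoothFun

variable {m : ℕ}

instance : CommRing (SmoothFun m) := inferInstanceAs (CommRing (smoothSubalgebra m))

instance : Algebra ℝ (SmoothFun m) := inferInstanceAs (Algebra ℝ (smoothSubalgebra m))

instance : CoeFun (SmoothFun m) fun _ => (Fin m → ℝ) → ℝ := ⟨fun f => f.1⟩

@[ext]
theorem ext {f g : SmoothFun m} (h : ∀ x, f x = g x) : f = g := Subtype.ext (funext h)

@[simp] theorem zero_apply (x : Fin m → ℝ) : (0 : SmoothFun m) x = 0 := rfl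
@[simp] theorem one_apply (x : Fin m → ℝ) : (1 : SmoothFun m) x = 1 := rfl
@[simp] theorem add_apply (f g : SmoothFun m) (x : Fin m → ℝ) : (f + g) x = f x + g x := rfl
@[simp] theorem mul_apply (f g : SmoothFun m) (x : Fin m → ℝ) : (f * g) x = f x * g x := rfl
@[simp] theorem smul_apply (c : ℝ) (f : SmoothFun m) (x : Fin m → ℝ) : (c • f) x = c * f x := rfl

theorem contDiff (f : SmoothFun m) : ContDiff ℝ ∞ f := f.2

theorem differentiableAt (f : SmoothFun m) (x : Fin m → ℝ) : DifferentiableAt ℝ f x :=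
  f.contDiff.differentiable (by simp) x

end SmoothFun

/-- The partial derivative `∂/∂x^i` on `C^∞(ℝ^m)`. -/
def pderivSmooth {m : ℕ} (i : Fin m) : Module.End ℝ (SmoothFun m) where
  toFun f := ⟨fun x => fderiv ℝ f x (Pi.single i 1),
    (f.contDiff.fderiv_right (m := ∞) le_rfl).clm_apply contDiff_const⟩
  map_add' f g := by
    ext x
    change fderiv ℝ (f.1 + g.1) x (Pi.single i 1) = _
    rw [fderiv_add (f.differentiableAt x) (g.differentiableAt x)]
    rfl
  map_smul' c f := by
    ext x
    change fderiv ℝ (c • f.1) x (Pi.single i 1) = _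
    rw [fderiv_const_smul (f.differentiableAt x) c]
    rfl

/-- The iterated partial derivative `∂^α = ∂_1^{α_1} ⋯ ∂_m^{α_m}` on `C^∞(ℝ^m)`. -/
def pderivMulti {m : ℕ} (α : Fin m →₀ ℕ) : Module.End ℝ (SmoothFun m) :=
  (List.ofFn fun i => pderivSmooth i ^ α i).prod

/-- The dimensions `n_0 ≤ n_N ≤ n_T` of the constraint manifold
`ℝⁿ = (ℝ^{n_T}, ℝ^{n_N}, ℝ^{n_0})`. It consists of `ℝ^{n_T}`, of the submanifold
`ℝ^{n_N} ⊆ ℝ^{n_T}` on which the coordinates with index `≥ n_N` vanish (coordinates are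
numbered from `0`), and of the distribution on `ℝ^{n_N}` spanned by the first `n_0` coordinate
directions. -/
structure ConDim where
  nT : ℕ
  nN : ℕ
  n0 : ℕ
  le_N : n0 ≤ nN
  le_T : nN ≤ nT

namespace ConDim

variable (n : ConDim)

/-- The submanifold `ℝ^{n_N} ⊆ ℝ^{n_T}`. -/
def sub : Set (Fin n.nT → ℝ) := {x | ∀ i : Fin n.nT, n.nN ≤ (i : ℕ) → x i = 0}

/-- The algebra `C^∞(ℝ^{n_T})`, which is the `T`-component of the constraint algebra
`CC^∞(ℝⁿ)` of functions. -/
abbrev Fun : Type := SmoothFun n.nT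

/-- The `0`-component of the constraint algebra of functions: functions vanishing on
`ℝ^{n_N}`. -/
def fun0 : Submodule ℝ n.Fun where
  carrier := {f | ∀ x ∈ n.sub, f x = 0}
  add_mem' hf hg x hx := by simp [hf x hx, hg x hx]
  zero_mem' x _ := rfl
  smul_mem' c f hf x hx := by simp [hf x hx]

/-- The `N`-component of the constraint algebra of functions: functions whose restriction to
`ℝ^{n_N}` is annihilated by the distribution `ℝ^{n_0}`. -/
def funN : Submodule ℝ n.Fun where
  carrier := {f | ∀ i : Fin n.nT, (i : ℕ) < n.n0 → ∀ x ∈ n.sub, pderivSmooth i f x = 0}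
  add_mem' hf hg i hi x hx := by simp [hf i hi x hx, hg i hi x hx]
  zero_mem' i _ x _ := by simp
  smul_mem' c f hf i hi x hx := by simp [hf i hi x hx]

end ConDim

/-! ### Hochschild cochains -/

/-- Hochschild `k`-cochains of a real algebra `A`. -/
abbrev HCochain (A : Type) [CommRing A] [Algebra ℝ A] (k : ℕ) : Type :=
  MultilinearMap ℝ (fun _ : Fin k => A) A

section Hochschild

variable {A : Type} [CommRing A] [Algebra ℝ A] {k : ℕ}

theorem exists_contractNth_update (i : Fin k) (a : Fin (k + 1) → A) (p : Fin (k + 1)) :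
    ∃ (q : Fin k) (L : A →ₗ[ℝ] A), ∀ v,
      Fin.contractNth i.castSucc (· * ·) (Function.update a p v) =
        Function.update (Fin.contractNth i.castSucc (· * ·) a) q (L v) := by
  rcases lt_trichotomy (p : ℕ) i with h | h | h
  · refine ⟨⟨p, by omega⟩, LinearMap.id, fun v => ?_⟩
    ext r
    simp only [Fin.contractNth, Function.update_apply, Fin.ext_iff, Fin.val_castSucc, Fin.val_succ,
      LinearMap.id_apply]
    split_ifs <;> first | rfl | omega
  · refine ⟨i, LinearMap.mulRight ℝ (a i.succ), fun v => ?_⟩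
    ext r
    by_cases hr : r = i
    · subst hr
      simp [Fin.contractNth, Function.update_apply, Fin.ext_iff, h]
    · have hr' : (r : ℕ) ≠ i := fun h => hr (Fin.ext h)
      simp only [Fin.contractNth, Function.update_apply, Fin.ext_iff, Fin.val_castSucc,
        Fin.val_succ]
      split_ifs <;> first | rfl | omega
  · by_cases h1 : (p : ℕ) = i + 1
    · refine ⟨i, LinearMap.mulLeft ℝ (a i.castSucc), fun v => ?_⟩
      ext r
      by_cases hr : r = i
      · subst hr
        simp [Fin.contractNth, Function.update_apply, Fin.ext_iff, h1]
      · have hr' : (r : ℕ) ≠ i := fun h => hr (Fin.ext h)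
        simp only [Fin.contractNth, Function.update_apply, Fin.ext_iff, Fin.val_castSucc,
          Fin.val_succ]
        split_ifs <;> first | rfl | omega
    · refine ⟨⟨p - 1, by omega⟩, LinearMap.id, fun v => ?_⟩
      ext r
      simp only [Fin.contractNth, Function.update_apply, Fin.ext_iff, Fin.val_castSucc,
        Fin.val_succ, LinearMap.id_apply]
      split_ifs <;> first | rfl | omega

/-- The cochain `(a_0, …, a_k) ↦ φ(a_0, …, a_i a_{i+1}, …, a_k)`. -/
def HCochain.contract (φ : HCochain A k) (i : Fin k) : HCochain A (k + 1) where
  toFun a := φ (Fin.contractNth i.castSucc (· * ·) a)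
  map_update_add' {inst} a p u v := by
    obtain rfl : inst = instDecidableEqFin (k + 1) := Subsingleton.elim _ _
    obtain ⟨q, L, h⟩ := exists_contractNth_update i a p
    simp only [h, map_add, φ.map_update_add]
  map_update_smul' {inst} a p c v := by
    obtain rfl : inst = instDecidableEqFin (k + 1) := Subsingleton.elim _ _
    obtain ⟨q, L, h⟩ := exists_contractNth_update i a p
    simp only [h, map_smul, φ.map_update_smul]

/-- The cochain `(a_0, …, a_k) ↦ a_0 φ(a_1, …, a_k)`. -/
def HCochain.mulHead (φ : HCochain A k) : HCochain A (k + 1) where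
  toFun a := a 0 * φ (Fin.tail a)
  map_update_add' {inst} a p u v := by
    obtain rfl : inst = instDecidableEqFin (k + 1) := Subsingleton.elim _ _
    refine Fin.cases ?_ (fun q => ?_) p
    · simp [Fin.tail_update_zero, add_mul]
    · simp [Fin.tail_update_succ, mul_add, Function.update_of_ne (Fin.succ_ne_zero q).symm]
  map_update_smul' {inst} a p c v := by
    obtain rfl : inst = instDecidableEqFin (k + 1) := Subsingleton.elim _ _
    refine Fin.cases ?_ (fun q => ?_) p
    · simp [Fin.tail_update_zero]
    · simp [Fin.tail_update_succ, Function.update_of_ne (Fin.succ_ne_zero q).symm]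

/-- The cochain `(a_0, …, a_k) ↦ φ(a_0, …, a_{k-1}) a_k`. -/
def HCochain.mulLast (φ : HCochain A k) : HCochain A (k + 1) where
  toFun a := φ (Fin.init a) * a (Fin.last k)
  map_update_add' {inst} a p u v := by
    obtain rfl : inst = instDecidableEqFin (k + 1) := Subsingleton.elim _ _
    refine Fin.lastCases ?_ (fun q => ?_) p
    · simp [Fin.init_update_last, mul_add]
    · simp [Fin.init_update_castSucc, add_mul, (Fin.castSucc_lt_last q).ne']
  map_update_smul' {inst} a p c v := by
    obtain rfl : inst = instDecidableEqFin (k + 1) := Subsingleton.elim _ _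
    refine Fin.lastCases ?_ (fun q => ?_) p
    · simp [Fin.init_update_last]
    · simp [Fin.init_update_castSucc, (Fin.castSucc_lt_last q).ne']

variable (A k) in
/-- The Hochschild differential
`(δφ)(a_0, …, a_k) = a_0 φ(a_1, …, a_k) + ∑_{i<k} (-1)^{i+1} φ(a_0, …, a_i a_{i+1}, …, a_k)
  + (-1)^{k+1} φ(a_0, …, a_{k-1}) a_k`. -/
def hochschildD : HCochain A k →ₗ[ℝ] HCochain A (k + 1) where
  toFun φ := φ.mulHead + ∑ i : Fin k, (-1 : ℝ) ^ ((i : ℕ) + 1) • φ.contract i +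
    (-1 : ℝ) ^ (k + 1) • φ.mulLast
  map_add' φ ψ := by
    ext a
    simp only [add_apply, sum_apply, smul_apply,
      HCochain.mulHead, HCochain.contract, HCochain.mulLast, MultilinearMap.coe_mk, mul_add,
      add_mul, smul_add, Finset.sum_add_distrib]
    abel
  map_smul' c φ := by
    ext a
    simp only [add_apply, sum_apply, smul_apply,
      HCochain.mulHead, HCochain.contract, HCochain.mulLast, MultilinearMap.coe_mk,
      mul_smul_comm, smul_mul_assoc, smul_add, Finset.smul_sum, RingHom.id_apply]
    simp only [smul_comm c]

theorem hochschildD_apply (φ : HCochain A k) (a : Fin (k + 1) → A) :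
    hochschildD A k φ a = a 0 * φ (Fin.tail a) +
      ∑ i : Fin k, (-1 : ℝ) ^ ((i : ℕ) + 1) • φ (Fin.contractNth i.castSucc (· * ·) a) +
      (-1 : ℝ) ^ (k + 1) • (φ (Fin.init a) * a (Fin.last k)) := by
  simp [hochschildD, HCochain.mulHead, HCochain.contract, HCochain.mulLast]

/-- A linear map `A → A` as a Hochschild `1`-cochain. -/
def HCochain.ofEnd (D : Module.End ℝ A) : HCochain A 1 :=
  MultilinearMap.ofSubsingleton ℝ A A (0 : Fin 1) D

end Hochschild

namespace ConDim

variable (n : ConDim)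

/-! ### The differential constraint Hochschild complex of `CC^∞(ℝⁿ)` -/

/-- The `k`-differential operator `(f_1, …, f_k) ↦ a · ∂^{α_1} f_1 ⋯ ∂^{α_k} f_k`. -/
def multiDiffMonomial {k : ℕ} (a : n.Fun) (α : Fin k → Fin n.nT →₀ ℕ) : HCochain n.Fun k :=
  a • (MultilinearMap.mkPiAlgebra ℝ (Fin k) n.Fun).compLinearMap fun i => pderivMulti (α i)

/-- The `T`-component of `C^k_diff(CC^∞(ℝⁿ))`: all `k`-differential operators on `ℝ^{n_T}`,
that is, all finite sums of operators `(f_1, …, f_k) ↦ a · ∂^{α_1} f_1 ⋯ ∂^{α_k} f_k` with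
`a` smooth. -/
def cochainT (k : ℕ) : Submodule ℝ (HCochain n.Fun k) :=
  Submodule.span ℝ {φ | ∃ a α, φ = n.multiDiffMonomial a α}

/-- The `N`-component of `C^k_diff(CC^∞(ℝⁿ))`: `k`-differential operators which are morphisms
`CC^∞(ℝⁿ)^{⊗ k} → CC^∞(ℝⁿ)` of constraint modules. As `CC^∞(ℝⁿ)_N → CC^∞(ℝⁿ)_T` is
injective, such a morphism is determined by its `T`-component; the `0`-component of the tensor
power is spanned by the tensors with all factors in the `N`-component and at least one factor in
the `0`-component. -/
def cochainN (k : ℕ) : Submodule ℝ (HCochain n.Fun k) where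
  carrier := {φ | φ ∈ n.cochainT k ∧
    (∀ f : Fin k → n.Fun, (∀ i, f i ∈ n.funN) → φ f ∈ n.funN) ∧
    (∀ f : Fin k → n.Fun, (∀ i, f i ∈ n.funN) → (∃ i, f i ∈ n.fun0) → φ f ∈ n.fun0)}
  add_mem' h h' := ⟨add_mem h.1 h'.1, fun f hf => add_mem (h.2.1 f hf) (h'.2.1 f hf),
    fun f hf h0 => add_mem (h.2.2 f hf h0) (h'.2.2 f hf h0)⟩
  zero_mem' := ⟨zero_mem _, fun _ _ => zero_mem _, fun _ _ _ => zero_mem _⟩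
  smul_mem' c _ h := ⟨Submodule.smul_mem _ c h.1,
    fun f hf => Submodule.smul_mem _ c (h.2.1 f hf),
    fun f hf h0 => Submodule.smul_mem _ c (h.2.2 f hf h0)⟩

/-- The `0`-component of `C^k_diff(CC^∞(ℝⁿ))`: those cochains in the `N`-component which map
`N`-components into the `0`-component. -/
def cochain0 (k : ℕ) : Submodule ℝ (HCochain n.Fun k) where
  carrier := {φ | φ ∈ n.cochainN k ∧
    ∀ f : Fin k → n.Fun, (∀ i, f i ∈ n.funN) → φ f ∈ n.fun0}
  add_mem' h h' := ⟨add_mem h.1 h'.1, fun f hf => add_mem (h.2 f hf) (h'.2 f hf)⟩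
  zero_mem' := ⟨zero_mem _, fun _ _ => zero_mem _⟩
  smul_mem' c _ h := ⟨Submodule.smul_mem _ c h.1, fun f hf => Submodule.smul_mem _ c (h.2 f hf)⟩

theorem cochainN_le_cochainT (k : ℕ) : n.cochainN k ≤ n.cochainT k := fun _ h => h.1

/-- `2`-cocycles of the `T`-component. -/
def cocycleT : Submodule ℝ (HCochain n.Fun 2) :=
  n.cochainT 2 ⊓ LinearMap.ker (hochschildD n.Fun 2)

/-- `2`-cocycles of the `N`-component. -/
def cocycleN : Submodule ℝ (HCochain n.Fun 2) :=
  n.cochainN 2 ⊓ LinearMap.ker (hochschildD n.Fun 2)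

/-- `2`-cocycles of the `0`-component. -/
def cocycle0 : Submodule ℝ (HCochain n.Fun 2) :=
  n.cochain0 2 ⊓ LinearMap.ker (hochschildD n.Fun 2)

/-- `2`-coboundaries of the `T`-component. -/
def coboundaryT : Submodule ℝ (HCochain n.Fun 2) := (n.cochainT 1).map (hochschildD n.Fun 1)

/-- `2`-coboundaries of the `N`-component. -/
def coboundaryN : Submodule ℝ (HCochain n.Fun 2) := (n.cochainN 1).map (hochschildD n.Fun 1)

theorem cocycleN_le_cocycleT : n.cocycleN ≤ n.cocycleT :=
  inf_le_inf_right _ (n.cochainN_le_cochainT 2)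

theorem coboundaryN_le_coboundaryT : n.coboundaryN ≤ n.coboundaryT :=
  Submodule.map_mono (n.cochainN_le_cochainT 1)

/-- The second differential constraint Hochschild cohomology `HH²_diff(CC^∞(ℝⁿ))`. -/
def HH2 : ConModule ℝ :=
  ConModule.subquotient n.cocycleT n.cocycleN n.cocycle0 n.coboundaryT n.coboundaryN
    n.cocycleN_le_cocycleT n.coboundaryN_le_coboundaryT

/-- The cohomology class in `HH²_diff(CC^∞(ℝⁿ))_T` of a cocycle. -/
def classT (φ : n.cocycleT) : n.HH2.T := ConModule.subquotient.mkT _ _ _ _ _ _ _ φ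

/-- The cohomology class in `HH²_diff(CC^∞(ℝⁿ))_N` of a cocycle. -/
def classN (φ : n.cocycleN) : n.HH2.N := ConModule.subquotient.mkN _ _ _ _ _ _ _ φ

/-! ### Constraint bivector fields -/

/-- Vector fields on `ℝ^{n_T}`; `X i` is the coefficient of `∂/∂x^i`. This is the `T`-component
of the constraint module of vector fields on `ℝⁿ`. -/
abbrev VecField : Type := Fin n.nT → n.Fun

/-- The `N`-component of the constraint module of vector fields on `ℝⁿ`: on `ℝ^{n_N}` the vector
field is tangent to `ℝ^{n_N}` and its class modulo the distribution `ℝ^{n_0}` is constant along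
the distribution. -/
def vecN : Submodule ℝ n.VecField where
  carrier := {X | (∀ i : Fin n.nT, n.nN ≤ (i : ℕ) → X i ∈ n.fun0) ∧
    ∀ i : Fin n.nT, n.n0 ≤ (i : ℕ) → (i : ℕ) < n.nN → X i ∈ n.funN}
  add_mem' h h' := ⟨fun i hi => add_mem (h.1 i hi) (h'.1 i hi),
    fun i hi hi' => add_mem (h.2 i hi hi') (h'.2 i hi hi')⟩
  zero_mem' := ⟨fun _ _ => zero_mem _, fun _ _ _ => zero_mem _⟩
  smul_mem' c _ h := ⟨fun i hi => Submodule.smul_mem _ c (h.1 i hi),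
    fun i hi hi' => Submodule.smul_mem _ c (h.2 i hi hi')⟩

/-- The `0`-component of the constraint module of vector fields on `ℝⁿ`: on `ℝ^{n_N}` the vector
field lies in the distribution `ℝ^{n_0}`. -/
def vec0 : Submodule ℝ n.VecField where
  carrier := {X | ∀ i : Fin n.nT, n.n0 ≤ (i : ℕ) → X i ∈ n.fun0}
  add_mem' h h' i hi := add_mem (h i hi) (h' i hi)
  zero_mem' _ _ := zero_mem _
  smul_mem' c _ h i hi := Submodule.smul_mem _ c (h i hi)

/-- Bivector fields on `ℝ^{n_T}`, the second exterior power over `C^∞(ℝ^{n_T})` of the module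
of vector fields. -/
abbrev Bivector : Type := ⋀[n.Fun]^2 n.VecField

/-- `X ∧ Y`. -/
def wedge (X Y : n.VecField) : n.Bivector := exteriorPower.ιMulti n.Fun 2 ![X, Y]

/-- The `0`-component of the bivector fields `Λ²` formed with the strong tensor product
`(E ⊠ E)_0 = E_0 ⊗ E_T + E_T ⊗ E_0`. -/
def biv0 : Submodule ℝ n.Bivector :=
  Submodule.span ℝ {B | ∃ X ∈ n.vec0, ∃ Y, B = n.wedge X Y}

/-- The `N`-component of the bivector fields `Λ²` formed with the strong tensor product
`(E ⊠ E)_N = E_N ⊗ E_N + E_0 ⊗ E_T + E_T ⊗ E_0`. -/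
def bivN : Submodule ℝ n.Bivector :=
  Submodule.span ℝ {B | ∃ X ∈ n.vecN, ∃ Y ∈ n.vecN, B = n.wedge X Y} ⊔ n.biv0

/-! ### The symmetric part -/

/-- Symmetric contravariant tensor fields along the submanifold `ℝ^{n_N}`, sections of
`Sym^•(Tℝ^{n_T})` restricted to `ℝ^{n_N}`: this is the symmetric algebra over `C^∞(ℝ^{n_N})` on
the frame `∂/∂x^1, …, ∂/∂x^{n_T}`, with `MvPolynomial.X i` standing for `∂/∂x^i` and the product
for `∨`. -/
abbrev SymTensorSub : Type := MvPolynomial (Fin n.nT) (SmoothFun n.nN)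

/-- Symmetric contravariant tensor fields on `ℝ^{n_T}`. -/
abbrev SymTensor : Type := MvPolynomial (Fin n.nT) n.Fun

/-- Sections over `ℝ^{n_N}` of the distribution `Tℝ^{n_0}`. -/
def symTangent0 : Submodule (SmoothFun n.nN) n.SymTensorSub :=
  Submodule.span _ {v | ∃ i : Fin n.nT, (i : ℕ) < n.n0 ∧ v = MvPolynomial.X i}

/-- Sections over `ℝ^{n_N}` of the complement `Tℝ^{n_T - n_N}` of the tangent bundle of
`ℝ^{n_N}`. -/
def symNormal : Submodule (SmoothFun n.nN) n.SymTensorSub :=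
  Submodule.span _ {v | ∃ i : Fin n.nT, n.nN ≤ (i : ℕ) ∧ v = MvPolynomial.X i}

/-- `⨁_{k ≥ 1} Sym^k Γ(Tℝ^{n_0}) ∨ Γ(Tℝ^{n_T - n_N})` along `ℝ^{n_N}`. -/
def symExt : Submodule (SmoothFun n.nN) n.SymTensorSub :=
  ⨆ k : ℕ, n.symTangent0 ^ (k + 1) * n.symNormal

/-- The prolongation `C^∞(ℝ^{n_N}) → C^∞(ℝ^{n_T})`, extending functions constantly in the
remaining coordinates. -/
def prolFun : SmoothFun n.nN →ₐ[ℝ] n.Fun where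
  toFun f := ⟨fun x => f fun i => x (Fin.castLE n.le_T i),
    f.contDiff.comp (contDiff_pi.2 fun i => contDiff_apply ℝ ℝ (Fin.castLE n.le_T i))⟩
  map_one' := rfl
  map_mul' _ _ := rfl
  map_zero' := rfl
  map_add' _ _ := rfl
  commutes' _ := rfl

/-- The prolongation of symmetric tensor fields, prolonging the coefficients. -/
def prol : n.SymTensorSub →+* n.SymTensor := MvPolynomial.map n.prolFun.toRingHom

/-- The symbol calculus of the canonical flat covariant derivative: the differential operator
with total symbol `D`. It is linear over `C^∞(ℝ^{n_T})` and maps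
`∂/∂x^{i_1} ∨ ⋯ ∨ ∂/∂x^{i_r}` to `∂^r/∂x^{i_1} ⋯ ∂x^{i_r}`. -/
def Op : n.SymTensor →ₗ[n.Fun] Module.End ℝ n.Fun :=
  (MvPolynomial.basisMonomials (Fin n.nT) n.Fun).constr n.Fun pderivMulti

/-! ### Extended constraint bivector fields and the HKR map -/

theorem biv0_le_bivN : n.biv0 ≤ n.bivN := le_sup_right

/-- The constraint module of extended constraint bivector fields on `ℝⁿ`. -/
def extBivector : ConModule ℝ where
  T := n.Bivector
  N := n.bivN × n.symExt
  ι := n.bivN.subtype ∘ₗ LinearMap.fst ℝ n.bivN n.symExt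
  zero := (n.biv0.submoduleOf n.bivN).prod ⊤

/-- The map sending a vector field `X` to `(X f_1, …, X f_k)`. -/
def applyFuns {k : ℕ} (f : Fin k → n.Fun) : n.VecField →ₗ[n.Fun] (Fin k → n.Fun) where
  toFun X b := ∑ i, X i * pderivSmooth i (f b)
  map_add' X Y := by
    ext1 b
    simp [add_mul, Finset.sum_add_distrib]
  map_smul' c X := by
    ext1 b
    simp [Finset.mul_sum, mul_assoc]

/-- The pairing of a bivector field with `(df_1, df_2)`; on `X ∧ Y` it is
`X f_1 · Y f_2 - X f_2 · Y f_1`. -/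
def insDiff (f : Fin 2 → n.Fun) : n.Bivector →ₗ[n.Fun] n.Fun :=
  exteriorPower.alternatingMapLinearEquiv (Matrix.detRowAlternating.compLinearMap (n.applyFuns f))

theorem insDiff_wedge (f : Fin 2 → n.Fun) (X Y : n.VecField) :
    n.insDiff f (n.wedge X Y) = n.applyFuns f X 0 * n.applyFuns f Y 1 -
      n.applyFuns f X 1 * n.applyFuns f Y 0 := by
  rw [insDiff, wedge, exteriorPower.alternatingMapLinearEquiv_apply_ιMulti]
  change Matrix.det (Matrix.of fun i => n.applyFuns f (![X, Y] i)) = _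
  rw [Matrix.det_fin_two]
  rfl

theorem insDiff_update_add (f : Fin 2 → n.Fun) (p : Fin 2) (u v : n.Fun) :
    n.insDiff (Function.update f p (u + v)) =
      n.insDiff (Function.update f p u) + n.insDiff (Function.update f p v) := by
  refine exteriorPower.linearMap_ext (AlternatingMap.ext fun X => ?_)
  have h : X = ![X 0, X 1] := by ext i; fin_cases i <;> rfl
  have h' := fun f => n.insDiff_wedge f (X 0) (X 1)
  simp only [wedge, ← h] at h'
  simp only [LinearMap.compAlternatingMap_apply, LinearMap.add_apply, h']
  fin_cases p <;> simp [applyFuns, Finset.sum_add_distrib, mul_add, add_mul] <;> ring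

theorem insDiff_update_smul (f : Fin 2 → n.Fun) (p : Fin 2) (c : ℝ) (v : n.Fun) :
    n.insDiff (Function.update f p (c • v)) = c • n.insDiff (Function.update f p v) := by
  refine exteriorPower.linearMap_ext (AlternatingMap.ext fun X => ?_)
  have h : X = ![X 0, X 1] := by ext i; fin_cases i <;> rfl
  have h' := fun f => n.insDiff_wedge f (X 0) (X 1)
  simp only [wedge, ← h] at h'
  simp only [LinearMap.compAlternatingMap_apply, LinearMap.smul_apply, h']
  fin_cases p <;> simp [applyFuns, ← Finset.smul_sum, smul_sub]

/-- The HKR map on bivector fields, `U(X)(f_1, f_2) = 1/2! · i_{df_1, df_2} X`. -/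
def hkr (X : n.Bivector) : HCochain n.Fun 2 where
  toFun f := (1 / (Nat.factorial 2 : ℝ)) • n.insDiff f X
  map_update_add' {inst} f p u v := by
    obtain rfl : inst = instDecidableEqFin 2 := Subsingleton.elim _ _
    simp [insDiff_update_add]
  map_update_smul' {inst} f p c v := by
    obtain rfl : inst = instDecidableEqFin 2 := Subsingleton.elim _ _
    simp [insDiff_update_smul, smul_comm c]

/-- The cochain `U(X) + δ(Op(prol(D)))`. -/
def hkrExt (X : n.Bivector) (D : n.SymTensorSub) : HCochain n.Fun 2 :=
  n.hkr X + hochschildD n.Fun 1 (HCochain.ofEnd (n.Op (n.prol D)))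

end ConDim

end

noncomputable section

/-! ### Regular monomorphisms of constraint modules -/

namespace ConModule

variable {R : Type} [CommRing R]

/-! Write C for the submanifold and A_N, A_0 for `funN`, `fun0`.

Well-definedness. U(X) is a biderivation, hence a cocycle, and δ² = 0. Vector fields in V_N preserve
A_N and A_0, and those in V_0 map A_N into A_0, so U respects the constraint components. For the
symmetric part, ∂_j is a derivation, and composing with ∂_i along the distribution preserves the
property of being a derivation on A_N modulo A_0 (`pderivSmooth_mul_mem_derivationsModFun0`). So
δ(Op(prol D)) maps A_N × A_N into A_0. It is a T-coboundary, which makes the two components of the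
map compatible.

Regularity. On a commutative algebra δψ is symmetric for every 1-cochain ψ, while U(X) is
antisymmetric. Alternating a representative on coordinate functions therefore recovers the
coefficients of X, whatever coboundary is added (`bivCoeff_eq_hkr_add_coboundary`). This gives
injectivity in the T-component. It also shows that a class in the 0-component has X^{ij} ∈ A_0
whenever x^i, x^j ∈ A_N, which forces X ∈ V_0 ∧ V_T (`mem_biv0_of_bivCoeff`).

For injectivity in the N-component it remains to exclude δ(Op(prol D)) = δψ with ψ a constraint
operator and D ≠ 0. Evaluate at p ∈ C on (x-p)^ν and x_j, where ν ≠ 0 and j is normal. Both factors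
vanish at p and their product lies in A_0, which ψ preserves, so only the coefficient of D at ν +
e_j survives, up to a nonzero factor (`eq_zero_of_hochschildD_eq`). -/

theorem mkQ_mem_map_mkQ_iff {V : Type*} [AddCommGroup V] [Module R V] (Z B : Submodule R V)
    (v : V) : B.mkQ v ∈ Z.map B.mkQ ↔ ∃ z ∈ Z, v - z ∈ B := by
  simp only [Submodule.mem_map, Submodule.mkQ_apply]
  exact exists_congr fun z => and_congr_right fun _ => eq_comm.trans (Submodule.Quotient.eq B)

/-- A pair of injective maps which reflects the `0`-component is an equalizer. -/
theorem isRegularMono_of_injective {E F : ConModule R} (U : E ⟶ F)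
    (hT : Function.Injective U.T) (hN : Function.Injective U.N)
    (h0 : F.zero.comap U.N = E.zero) : IsRegularMono U := by
  -- The cokernel of `U`, with full 0-component so that both the projection and the zero map are
  -- morphisms into it; `U` is their equalizer.
  let G : ConModule R :=
    { T := F.T ⧸ LinearMap.range U.T
      N := F.N ⧸ LinearMap.range U.N
      ι := Submodule.mapQ _ _ F.ι (by rintro _ ⟨x, rfl⟩; exact ⟨E.ι x, U.comm x⟩)
      zero := ⊤ }
  let p : F ⟶ G := ⟨Submodule.mkQ _, Submodule.mkQ _, fun x => rfl, fun _ _ => Submodule.mem_top⟩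
  let q : F ⟶ G := ⟨0, 0, fun x => (map_zero G.ι).symm, fun _ _ => Submodule.mem_top⟩
  have hw : U ≫ p = U ≫ q := by
    refine Hom.ext (LinearMap.ext fun x => ?_) (LinearMap.ext fun x => ?_)
    · exact (Submodule.Quotient.mk_eq_zero _).2 ⟨x, rfl⟩
    · exact (Submodule.Quotient.mk_eq_zero _).2 ⟨x, rfl⟩
  refine ⟨⟨⟨G, p, q, hw, Limits.Fork.IsLimit.mk' _ fun s => ?_⟩⟩⟩
  have hs := s.condition
  have hsT : ∀ x, s.ι.T x ∈ LinearMap.range U.T := fun x =>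
    (Submodule.Quotient.mk_eq_zero _).1 (LinearMap.congr_fun (congrArg Hom.T hs) x)
  have hsN : ∀ x, s.ι.N x ∈ LinearMap.range U.N := fun x =>
    (Submodule.Quotient.mk_eq_zero _).1 (LinearMap.congr_fun (congrArg Hom.N hs) x)
  let eT := LinearEquiv.ofInjective U.T hT
  let eN := LinearEquiv.ofInjective U.N hN
  let LT : s.pt.T →ₗ[R] E.T := eT.symm.toLinearMap ∘ₗ s.ι.T.codRestrict _ hsT
  let LN : s.pt.N →ₗ[R] E.N := eN.symm.toLinearMap ∘ₗ s.ι.N.codRestrict _ hsN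
  have hLT : ∀ x, U.T (LT x) = s.ι.T x := fun x =>
    congrArg Subtype.val (eT.apply_symm_apply ⟨s.ι.T x, hsT x⟩)
  have hLN : ∀ x, U.N (LN x) = s.ι.N x := fun x =>
    congrArg Subtype.val (eN.apply_symm_apply ⟨s.ι.N x, hsN x⟩)
  let L : s.pt ⟶ E :=
    { T := LT
      N := LN
      comm := fun x => hT (by rw [hLT, U.comm, hLN]; exact s.ι.comm x)
      map_zero_comp := fun x hx => by
        -- Reflection of the 0-component is exactly what makes the factorization a morphism.
        rw [← h0, Submodule.mem_comap, hLN]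
        exact s.ι.map_zero_comp x hx }
  refine ⟨L, Hom.ext (LinearMap.ext hLT) (LinearMap.ext hLN), fun {l} hl => ?_⟩
  refine Hom.ext (LinearMap.ext fun x => hT ?_) (LinearMap.ext fun x => hN ?_)
  · exact (LinearMap.congr_fun (congrArg Hom.T hl) x).trans (hLT x).symm
  · exact (LinearMap.congr_fun (congrArg Hom.N hl) x).trans (hLN x).symm

end ConModule

/-! ### Partial derivatives -/

theorem List.prod_ofFn_mul_of_commute {M : Type*} [Monoid M] {m : ℕ} (f g : Fin m → M)
    (h : ∀ i j, Commute (f i) (g j)) :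
    (List.ofFn fun i => f i * g i).prod = (List.ofFn f).prod * (List.ofFn g).prod := by
  induction m with
  | zero => simp
  | succ m ih =>
    have hc : Commute (List.ofFn fun i => f (Fin.succ i)).prod (g 0) :=
      Commute.list_prod_left _ _ fun x hx => by
        obtain ⟨i, rfl⟩ := List.mem_ofFn.1 hx
        exact h _ _
    simp only [List.ofFn_succ, List.prod_cons,
      ih (fun i => f i.succ) (fun i => g i.succ) fun i j => h _ _]
    rw [mul_assoc, mul_assoc, ← mul_assoc (g 0), ← hc.eq, mul_assoc]

section PartialDerivatives

variable {m : ℕ}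

@[simp] theorem SmoothFun.sub_apply (f g : SmoothFun m) (x : Fin m → ℝ) :
    (f - g) x = f x - g x := rfl

@[simp] theorem SmoothFun.algebraMap_apply (c : ℝ) (x : Fin m → ℝ) :
    (algebraMap ℝ (SmoothFun m) c) x = c := rfl

theorem pderivSmooth_apply (i : Fin m) (f : SmoothFun m) (x : Fin m → ℝ) :
    pderivSmooth i f x = fderiv ℝ f x (Pi.single i 1) := rfl

theorem pderivSmooth_mul (i : Fin m) (f g : SmoothFun m) :
    pderivSmooth i (f * g) = f * pderivSmooth i g + pderivSmooth i f * g := by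
  ext x
  simp only [SmoothFun.add_apply, SmoothFun.mul_apply, pderivSmooth_apply]
  change fderiv ℝ (f.1 * g.1) x (Pi.single i 1) = _
  rw [fderiv_mul (f.differentiableAt x) (g.differentiableAt x)]
  simp [mul_comm]

/-- Both orders evaluate the second Fréchet derivative, which is symmetric for smooth functions. -/
theorem pderivSmooth_commute (i j : Fin m) :
    Commute (pderivSmooth i : Module.End ℝ (SmoothFun m)) (pderivSmooth j) := by
  have key : ∀ (i j : Fin m) (f : SmoothFun m) (x : Fin m → ℝ),
      pderivSmooth i (pderivSmooth j f) x =
        fderiv ℝ (fderiv ℝ f) x (Pi.single i 1) (Pi.single j 1) := fun i j f x => by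
    have hd : DifferentiableAt ℝ (fderiv ℝ f) x :=
      (f.contDiff.fderiv_right (m := ∞) le_rfl).differentiable (by simp) x
    rw [pderivSmooth_apply]
    change fderiv ℝ (fun y => fderiv ℝ f y (Pi.single j 1)) x (Pi.single i 1) = _
    rw [fderiv_clm_apply hd (differentiableAt_const _)]
    simp
  refine LinearMap.ext fun f => SmoothFun.ext fun x => ?_
  change pderivSmooth i (pderivSmooth j f) x = pderivSmooth j (pderivSmooth i f) x
  rw [key, key]
  exact (f.contDiff.contDiffAt.isSymmSndFDerivAt
    (by
    rw [minSmoothness_of_isRCLikeNormedField]; exact WithTop.coe_le_coe.2 le_top)).eq _ _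

theorem pderivMulti_add (α β : Fin m →₀ ℕ) :
    (pderivMulti (α + β) : Module.End ℝ (SmoothFun m)) = pderivMulti α * pderivMulti β := by
  simp only [pderivMulti, Finsupp.add_apply, pow_add]
  exact List.prod_ofFn_mul_of_commute _ _ fun i j => (pderivSmooth_commute i j).pow_pow _ _

@[simp] theorem pderivMulti_zero :
    (pderivMulti 0 : Module.End ℝ (SmoothFun m)) = 1 := by
  simp [pderivMulti]

theorem pderivMulti_single (i : Fin m) :
    (pderivMulti (Finsupp.single i 1) : Module.End ℝ (SmoothFun m)) = pderivSmooth i := by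
  -- The list length is decoupled from `m` and the family is arbitrary, so that induction can pass
  -- to the tail.
  have h : ∀ (k : ℕ) (i : Fin k) (f : Fin k → Module.End ℝ (SmoothFun m)),
      (List.ofFn fun j => f j ^ (Finsupp.single i 1 : Fin k →₀ ℕ) j).prod = f i := by
    intro k
    induction k with
    | zero => exact fun i => i.elim0
    | succ k ih =>
      intro i f
      rw [List.ofFn_succ, List.prod_cons]
      refine Fin.cases ?_ (fun i => ?_) i
      · have : ∀ j : Fin k, (Finsupp.single (0 : Fin (k + 1)) 1 : _ →₀ ℕ) j.succ = 0 := fun j =>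
          Finsupp.single_eq_of_ne (Fin.succ_ne_zero j)
        simp [this]
      · have : ∀ j : Fin k, (Finsupp.single i.succ 1 : _ →₀ ℕ) j.succ =
          (Finsupp.single i 1 : _ →₀ ℕ) j := fun j => by
          simp [Finsupp.single_apply]
        simp only [this]
        rw [ih i fun j => f j.succ]
        simp
  exact h m i _

theorem pderivMulti_single_add (i : Fin m) (α : Fin m →₀ ℕ) (f : SmoothFun m) :
    pderivMulti (Finsupp.single i 1 + α) f = pderivSmooth i (pderivMulti α f) := by
  rw [pderivMulti_add, pderivMulti_single]
  rfl

/-- Induction on multi-indices by adding one unit at a time. -/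
theorem multiIndex_induction {p : (Fin m →₀ ℕ) → Prop} (α : Fin m →₀ ℕ) (zero : p 0)
    (add : ∀ i α, p α → p (Finsupp.single i 1 + α)) : p α := by
  -- Starting from an arbitrary β lets the sum case of the induction chain its two hypotheses.
  suffices h : ∀ β, p β → p (α + β) by simpa using h 0 zero
  induction α using Finsupp.induction_linear with
  | zero => simp
  | add α γ hα hγ => exact fun β hβ => by rw [add_assoc]; exact hα _ (hγ _ hβ)
  | single i k =>
    induction k with
    | zero => simp
    | succ k ih =>
      intro β hβ
      rw [add_comm k, Finsupp.single_add, add_assoc]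
      exact add _ _ (ih _ hβ)

/-- `x ↦ x_i` -/
def coordFun (i : Fin m) : SmoothFun m := ⟨fun x => x i, (contDiff_apply ℝ ℝ i : ContDiff ℝ ∞ _)⟩

@[simp] theorem coordFun_apply (i : Fin m) (x : Fin m → ℝ) : coordFun i x = x i := rfl

theorem pderivSmooth_coordFun (i j : Fin m) :
    pderivSmooth i (coordFun j) = if i = j then 1 else 0 := by
  ext x
  rw [pderivSmooth_apply]
  change fderiv ℝ (fun x : Fin m → ℝ => x j) x (Pi.single i 1) = _
  rw [(hasFDerivAt_apply j x).fderiv]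
  by_cases h : i = j
  · subst h; simp
  · simp [h, Ne.symm h]

theorem pderivSmooth_one (i : Fin m) : pderivSmooth i (1 : SmoothFun m) = 0 := by
  ext x
  rw [pderivSmooth_apply]
  change fderiv ℝ (fun _ => (1 : ℝ)) x (Pi.single i 1) = 0
  simp

/-- The partial derivative as a derivation. -/
def pderivDerivation (i : Fin m) : Derivation ℝ (SmoothFun m) (SmoothFun m) where
  toLinearMap := pderivSmooth i
  map_one_eq_zero' := pderivSmooth_one i
  leibniz' f g := by
    change pderivSmooth i (f * g) = _
    rw [pderivSmooth_mul, mul_comm (pderivSmooth i f)]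
    rfl

/-- Polynomials in `x - p` as smooth functions. -/
def polyFun (p : Fin m → ℝ) : MvPolynomial (Fin m) ℝ →ₐ[ℝ] SmoothFun m :=
  MvPolynomial.aeval fun i => coordFun i - algebraMap ℝ _ (p i)

@[simp] theorem polyFun_X (p : Fin m → ℝ) (i : Fin m) :
    polyFun p (MvPolynomial.X i) = coordFun i - algebraMap ℝ _ (p i) :=
  MvPolynomial.aeval_X _ _

theorem pderivSmooth_polyFun (p : Fin m → ℝ) (i : Fin m) (q : MvPolynomial (Fin m) ℝ) :
    pderivSmooth i (polyFun p q) = polyFun p (MvPolynomial.pderiv i q) := by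
  induction q using MvPolynomial.induction_on with
  | C a =>
    have h := (pderivDerivation i).map_algebraMap a
    rw [← MvPolynomial.algebraMap_eq, AlgHom.commutes, MvPolynomial.algebraMap_eq,
      MvPolynomial.pderiv_C, map_zero]
    exact h
  | add q r hq hr => simp only [map_add, hq, hr]
  | mul_X q j hq =>
    have h : pderivSmooth i (algebraMap ℝ (SmoothFun m) (p j)) = 0 :=
      (pderivDerivation i).map_algebraMap (p j)
    rw [map_mul, pderivSmooth_mul, hq, Derivation.leibniz, map_add, smul_eq_mul, smul_eq_mul,
      map_mul, map_mul, polyFun_X, map_sub, h, pderivSmooth_coordFun, MvPolynomial.pderiv_X,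
      mul_comm (polyFun p (MvPolynomial.pderiv i q))]
    rcases eq_or_ne i j with rfl | hij
    · simp
    · simp [hij]

theorem polyFun_apply_self (p : Fin m → ℝ) (q : MvPolynomial (Fin m) ℝ) :
    polyFun p q p = MvPolynomial.constantCoeff q := by
  induction q using MvPolynomial.induction_on with
  | C a =>
    rw [← MvPolynomial.algebraMap_eq, AlgHom.commutes, MvPolynomial.algebraMap_eq]
    simp
  | add q r hq hr => simp [hq, hr]
  | mul_X q j hq => simp

/-- Only the `μ`-th derivative of `(x - p)^μ` at `p` among the derivatives at `p` is nonzero. -/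
theorem pderivMulti_polyFun_monomial_apply_self (p : Fin m → ℝ) (μ β : Fin m →₀ ℕ) (c : ℝ)
    (hc : c ≠ 0) :
    pderivMulti μ (polyFun p (MvPolynomial.monomial β c)) p ≠ 0 ↔ μ = β := by
  -- Each derivative lowers β and multiplies the coefficient by `β i`, so both must vary.
  induction μ using multiIndex_induction generalizing β c with
  | zero =>
    simp [polyFun_apply_self, MvPolynomial.constantCoeff_monomial, hc, eq_comm]
  | add i μ ih =>
    rw [add_comm, pderivMulti_add, pderivMulti_single, Module.End.mul_apply,
      pderivSmooth_polyFun, MvPolynomial.pderiv_monomial]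
    by_cases hβ : β i = 0
    · simp only [hβ, Nat.cast_zero, mul_zero, map_zero, SmoothFun.zero_apply, ne_eq,
        not_true_eq_false, false_iff]
      rintro rfl
      simp at hβ
    · rw [ih _ _ (mul_ne_zero hc (Nat.cast_ne_zero.2 hβ))]
      have hle : Finsupp.single i 1 ≤ β :=
        Finsupp.single_le_iff.2 (Nat.one_le_iff_ne_zero.2 hβ)
      exact eq_tsub_iff_add_eq_of_le hle

end PartialDerivatives

/-! ### Hochschild cochains in low degree -/

section LowDegree

variable {A : Type} [CommRing A] [Algebra ℝ A]

theorem hochschildD_one_apply (φ : HCochain A 1) (a : Fin 2 → A) :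
    hochschildD A 1 φ a = a 0 * φ ![a 1] - φ ![a 0 * a 1] + φ ![a 0] * a 1 := by
  have h0 : Fin.tail a = ![a 1] := by ext i; fin_cases i; rfl
  have h1 : Fin.init a = ![a 0] := by ext i; fin_cases i; rfl
  have h2 : Fin.contractNth (Fin.castSucc (0 : Fin 1)) (· * ·) a = ![a 0 * a 1] := by
    ext i; fin_cases i; rfl
  rw [hochschildD_apply, Fin.sum_univ_one, h0, h1, h2]
  simp [sub_eq_add_neg, Fin.last]

theorem hochschildD_two_apply (φ : HCochain A 2) (a : Fin 3 → A) :
    hochschildD A 2 φ a = a 0 * φ ![a 1, a 2] - φ ![a 0 * a 1, a 2] + φ ![a 0, a 1 * a 2] -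
      φ ![a 0, a 1] * a 2 := by
  have h0 : Fin.tail a = ![a 1, a 2] := by ext i; fin_cases i <;> rfl
  have h1 : Fin.init a = ![a 0, a 1] := by ext i; fin_cases i <;> rfl
  have h2 : Fin.contractNth (Fin.castSucc (0 : Fin 2)) (· * ·) a = ![a 0 * a 1, a 2] := by
    ext i; fin_cases i <;> rfl
  have h3 : Fin.contractNth (Fin.castSucc (1 : Fin 2)) (· * ·) a = ![a 0, a 1 * a 2] := by
    ext i; fin_cases i <;> rfl
  rw [hochschildD_apply, Fin.sum_univ_two, h0, h1, h2, h3]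
  have h4 : Fin.last 2 = 2 := rfl
  simp only [Fin.val_zero, Fin.val_one, h4]
  norm_num
  ring

theorem hochschildD_two_hochschildD_one (φ : HCochain A 1) :
    hochschildD A 2 (hochschildD A 1 φ) = 0 := by
  ext a
  rw [hochschildD_two_apply]
  simp only [hochschildD_one_apply, Matrix.cons_val_zero, Matrix.cons_val_one,
    Matrix.cons_val_fin_one, zero_apply, mul_assoc]
  ring

/-- Commutativity makes 1-coboundaries symmetric; this is what separates them from bivector fields.
-/
theorem hochschildD_one_symm (φ : HCochain A 1) (f g : A) :
    hochschildD A 1 φ ![f, g] = hochschildD A 1 φ ![g, f] := by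
  simp only [hochschildD_one_apply, Matrix.cons_val_zero, Matrix.cons_val_one,
    Matrix.cons_val_fin_one]
  rw [mul_comm f g]
  ring

@[simp] theorem HCochain.ofEnd_apply (D : Module.End ℝ A) (a : Fin 1 → A) :
    HCochain.ofEnd D a = D (a 0) := rfl

/-- `(f, g) ↦ D (f g)` -/
def HCochain.mulComp (D : Module.End ℝ A) : HCochain A 2 :=
  D.compMultilinearMap (MultilinearMap.mkPiAlgebra ℝ (Fin 2) A)

theorem HCochain.mulComp_apply (D : Module.End ℝ A) (a : Fin 2 → A) :
    HCochain.mulComp D a = D (a 0 * a 1) := by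
  simp [HCochain.mulComp]

end LowDegree

namespace ConDim

variable (n : ConDim)

/-! ### Differential operators -/

theorem multiDiffMonomial_apply {k : ℕ} (a : n.Fun) (α : Fin k → Fin n.nT →₀ ℕ)
    (f : Fin k → n.Fun) :
    n.multiDiffMonomial a α f = a * ∏ i, pderivMulti (α i) (f i) := rfl

theorem multiDiffMonomial_mem {k : ℕ} (a : n.Fun) (α : Fin k → Fin n.nT →₀ ℕ) :
    n.multiDiffMonomial a α ∈ n.cochainT k := Submodule.subset_span ⟨a, α, rfl⟩

theorem smul_mem_cochainT {k : ℕ} (a : n.Fun) {φ : HCochain n.Fun k} (h : φ ∈ n.cochainT k) :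
    a • φ ∈ n.cochainT k := by
  induction h using Submodule.span_induction with
  | mem φ h =>
    obtain ⟨b, α, rfl⟩ := h
    convert n.multiDiffMonomial_mem (a * b) α using 1
    simp [multiDiffMonomial, mul_smul]
  | zero => simp
  | add φ ψ _ _ hφ hψ => rw [smul_add]; exact add_mem hφ hψ
  | smul c φ _ hφ => 
    have hc : a • c • φ = c • a • φ := by
      ext1 f
      simp only [smul_apply]
      exact smul_comm _ _ _
    rw [hc]
    exact Submodule.smul_mem _ c hφ

/-- Leibniz on a product of three factors. Iterating it shows that (f, g) ↦ ∂^α(fg) is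
bidifferential without the binomial expansion. -/
theorem pderivSmooth_comp_mem_cochainT (i : Fin n.nT) {φ : HCochain n.Fun 2}
    (h : φ ∈ n.cochainT 2) :
    (pderivSmooth i).compMultilinearMap φ ∈ n.cochainT 2 := by
  induction h using Submodule.span_induction with
  | mem φ h =>
    obtain ⟨b, α, rfl⟩ := h
    convert add_mem (add_mem (n.multiDiffMonomial_mem (pderivSmooth i b) α)
      (n.multiDiffMonomial_mem b ![Finsupp.single i 1 + α 0, α 1]))
      (n.multiDiffMonomial_mem b ![α 0, Finsupp.single i 1 + α 1]) using 1
    ext1 f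
    simp only [LinearMap.compMultilinearMap_apply, multiDiffMonomial_apply, add_apply,
      Fin.prod_univ_two, Matrix.cons_val_zero, Matrix.cons_val_one, Matrix.cons_val_fin_one,
      pderivMulti_single_add, pderivSmooth_mul]
    ring
  | zero => simp
  | add φ ψ _ _ hφ hψ => rw [LinearMap.compMultilinearMap_add]; exact add_mem hφ hψ
  | smul c φ _ hφ =>
    rw [LinearMap.compMultilinearMap_smul]; exact Submodule.smul_mem _ c hφ

theorem mulComp_pderivMulti_mem_cochainT (α : Fin n.nT →₀ ℕ) :
    HCochain.mulComp (pderivMulti α) ∈ n.cochainT 2 := by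
  induction α using multiIndex_induction with
  | zero =>
    convert n.multiDiffMonomial_mem 1 ![0, 0] using 1
    ext1 f
    simp [HCochain.mulComp_apply, multiDiffMonomial_apply]
  | add i α ih =>
    convert n.pderivSmooth_comp_mem_cochainT i ih using 1
    ext1 f
    simp [HCochain.mulComp_apply, pderivMulti_single_add]

theorem hochschildD_pderivMulti_mem_cochainT (α : Fin n.nT →₀ ℕ) :
    hochschildD n.Fun 1 (HCochain.ofEnd (pderivMulti α)) ∈ n.cochainT 2 := by
  convert add_mem (sub_mem (n.multiDiffMonomial_mem 1 ![0, α])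
    (n.mulComp_pderivMulti_mem_cochainT α)) (n.multiDiffMonomial_mem 1 ![α, 0]) using 1
  ext1 f
  simp [hochschildD_one_apply, HCochain.mulComp_apply, multiDiffMonomial_apply, sub_apply]

theorem Op_apply (E : n.SymTensor) :
    n.Op E = ∑ μ ∈ E.support, E.coeff μ • pderivMulti μ := by
  rw [Op, Module.Basis.constr_apply]
  rfl

theorem hochschildD_ofEnd_smul (a : n.Fun) (φ : Module.End ℝ n.Fun) :
    hochschildD n.Fun 1 (HCochain.ofEnd (a • φ)) =
      a • hochschildD n.Fun 1 (HCochain.ofEnd φ) := by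
  ext1 f
  simp [hochschildD_one_apply]
  ring

theorem ofEnd_Op_eq_sum (E : n.SymTensor) : HCochain.ofEnd (n.Op E) =
    ∑ μ ∈ E.support, HCochain.ofEnd (E.coeff μ • pderivMulti μ) := by
  ext1 f
  simp [Op_apply]

theorem ofEnd_Op_mem_cochainT (E : n.SymTensor) : HCochain.ofEnd (n.Op E) ∈ n.cochainT 1 := by
  rw [ofEnd_Op_eq_sum]
  refine sum_mem fun μ _ => ?_
  convert n.multiDiffMonomial_mem (E.coeff μ) ![μ] using 1
  ext1 f
  simp [multiDiffMonomial_apply]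

theorem hochschildD_Op_mem_cochainT (E : n.SymTensor) :
    hochschildD n.Fun 1 (HCochain.ofEnd (n.Op E)) ∈ n.cochainT 2 := by
  rw [ofEnd_Op_eq_sum, map_sum]
  refine sum_mem fun μ _ => ?_
  rw [hochschildD_ofEnd_smul]
  exact n.smul_mem_cochainT _ (n.hochschildD_pderivMulti_mem_cochainT μ)

/-! ### Bivector fields -/

theorem linearMap_ext_wedge {M : Type*} [AddCommGroup M] [Module n.Fun M]
    {F G : n.Bivector →ₗ[n.Fun] M} (h : ∀ X Y, F (n.wedge X Y) = G (n.wedge X Y)) : F = G := by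
  refine exteriorPower.linearMap_ext (AlternatingMap.ext fun X => ?_)
  have hX : X = ![X 0, X 1] := by ext i; fin_cases i <;> rfl
  rw [hX]
  exact h _ _

@[simp] theorem applyFuns_apply {k : ℕ} (f : Fin k → n.Fun) (X : n.VecField) (b : Fin k) :
    n.applyFuns f X b = ∑ i, X i * pderivSmooth i (f b) := rfl

/-- The coefficient `X(dx^i, dx^j)` of a bivector field. -/
def bivCoeff (i j : Fin n.nT) : n.Bivector →ₗ[n.Fun] n.Fun :=
  n.insDiff ![coordFun i, coordFun j]

theorem bivCoeff_wedge (i j : Fin n.nT) (X Y : n.VecField) :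
    n.bivCoeff i j (n.wedge X Y) = X i * Y j - X j * Y i := by
  simp [bivCoeff, insDiff_wedge, pderivSmooth_coordFun]

theorem insDiff_eq_sum (f : Fin 2 → n.Fun) (X : n.Bivector) :
    n.insDiff f X =
      ∑ i, ∑ j, n.bivCoeff i j X * (pderivSmooth i (f 0) * pderivSmooth j (f 1)) := by
  have h : n.insDiff f = ∑ i, ∑ j,
      (pderivSmooth i (f 0) * pderivSmooth j (f 1)) • n.bivCoeff i j := by
    refine n.linearMap_ext_wedge fun X Y => ?_
    simp only [insDiff_wedge, LinearMap.sum_apply, LinearMap.smul_apply, bivCoeff_wedge,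
      applyFuns_apply, Finset.sum_mul_sum, smul_eq_mul, mul_sub, Finset.sum_sub_distrib]
    congr 1
    · exact Finset.sum_congr rfl fun i _ => Finset.sum_congr rfl fun j _ => by ring
    · rw [Finset.sum_comm]
      exact Finset.sum_congr rfl fun i _ => Finset.sum_congr rfl fun j _ => by ring
  rw [h]
  simp [mul_comm]

theorem wedge_swap (X Y : n.VecField) : n.wedge Y X = -n.wedge X Y := by
  have h := (exteriorPower.ιMulti n.Fun 2).map_swap ![X, Y] (Fin.zero_ne_one)
  rw [wedge, wedge, ← h]
  congr 1
  ext i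
  fin_cases i <;> rfl

/-- The wedge product as a bilinear map. -/
def wedgeBilin : n.VecField →ₗ[n.Fun] n.VecField →ₗ[n.Fun] n.Bivector :=
  have hadd : ∀ X X' Y, n.wedge (X + X') Y = n.wedge X Y + n.wedge X' Y := fun X X' Y =>
    (exteriorPower.ιMulti n.Fun 2).toMultilinearMap.cons_add ![Y] X X'
  have hsmul : ∀ (c : n.Fun) X Y, n.wedge (c • X) Y = c • n.wedge X Y := fun c X Y =>
    (exteriorPower.ιMulti n.Fun 2).toMultilinearMap.cons_smul ![Y] c X
  LinearMap.mk₂ n.Fun n.wedge hadd hsmul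
    (fun X Y Y' => by
      rw [n.wedge_swap (Y + Y'), hadd, n.wedge_swap Y, n.wedge_swap Y']; simp [add_comm])
    (fun c X Y => by rw [n.wedge_swap (c • Y), hsmul, n.wedge_swap Y]; simp)

@[simp] theorem wedgeBilin_apply (X Y : n.VecField) : n.wedgeBilin X Y = n.wedge X Y := rfl

theorem smul_wedge (c : n.Fun) (X Y : n.VecField) : n.wedge (c • X) Y = c • n.wedge X Y := by
  simp only [← wedgeBilin_apply, map_smul, LinearMap.smul_apply]

theorem wedge_eq_sum (X Y : n.VecField) : n.wedge X Y =
    ∑ i, ∑ j, (X i * Y j) • n.wedge (Pi.single i 1) (Pi.single j 1) := by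
  have h : ∀ X : n.VecField, X = ∑ i, X i • (Pi.single i 1 : n.VecField) := pi_eq_sum_univ'
  conv_lhs => rw [h X, h Y, ← wedgeBilin_apply]
  simp only [map_sum, map_smul, LinearMap.sum_apply, LinearMap.smul_apply, wedgeBilin_apply]
  simp only [Finset.smul_sum, smul_smul]
  rw [Finset.sum_comm]
  simp only [mul_comm]

/-- Summing over all ordered pairs counts each ∂_i ∧ ∂_j with i < j twice. Accepting the factor 2
avoids choosing a basis of the exterior square. -/
theorem two_smul_eq_sum_wedge (X : n.Bivector) :
    (2 : n.Fun) • X = ∑ i, ∑ j, n.bivCoeff i j X •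
      n.wedge (Pi.single i 1) (Pi.single j 1) := by
  have h : (2 : n.Fun) • LinearMap.id = ∑ i, ∑ j,
      (n.bivCoeff i j).smulRight (n.wedge (Pi.single i 1) (Pi.single j 1)) := by
    refine n.linearMap_ext_wedge fun X Y => ?_
    simp only [LinearMap.sum_apply, LinearMap.smulRight_apply, bivCoeff_wedge, sub_smul,
      Finset.sum_sub_distrib, ← wedge_eq_sum]
    simp only [mul_comm (X _), ← wedge_eq_sum, n.wedge_swap X Y]
    simp [two_smul]
  simpa using LinearMap.congr_fun h X

theorem hkr_apply (X : n.Bivector) (f : Fin 2 → n.Fun) :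
    n.hkr X f = (1 / 2 : ℝ) • n.insDiff f X := by
  simp [hkr]

/-- The HKR map as a linear map. -/
def hkrLin : n.Bivector →ₗ[ℝ] HCochain n.Fun 2 where
  toFun := n.hkr
  map_add' X Y := by ext1 f; simp [hkr_apply]
  map_smul' c X := by
    ext1 f
    have h : n.insDiff f (c • X) = c • n.insDiff f X :=
      LinearMap.map_smul_of_tower _ _ _
    simp only [hkr_apply, h, RingHom.id_apply, smul_apply, smul_comm c]

@[simp] theorem hkrLin_apply (X : n.Bivector) : n.hkrLin X = n.hkr X := rfl

theorem hkr_mem_cochainT (X : n.Bivector) : n.hkr X ∈ n.cochainT 2 := by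
  have h : n.hkr X = (1 / 2 : ℝ) • ∑ i, ∑ j, n.multiDiffMonomial (n.bivCoeff i j X)
      ![Finsupp.single i 1, Finsupp.single j 1] := by
    ext1 f
    simp [hkr_apply, insDiff_eq_sum, multiDiffMonomial_apply, pderivMulti_single, sum_apply]
  rw [h]
  exact Submodule.smul_mem _ _ (sum_mem fun i _ => sum_mem fun j _ => n.multiDiffMonomial_mem _ _)

/-- The Leibniz rule in each argument makes the four terms cancel in pairs. -/
theorem hochschildD_hkr (X : n.Bivector) : hochschildD n.Fun 2 (n.hkr X) = 0 := by
  ext1 f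
  simp only [hochschildD_two_apply, hkr_apply, zero_apply, mul_smul_comm,
    smul_mul_assoc, ← smul_sub, ← smul_add]
  suffices h : f 0 * n.insDiff ![f 1, f 2] X - n.insDiff ![f 0 * f 1, f 2] X +
      n.insDiff ![f 0, f 1 * f 2] X - n.insDiff ![f 0, f 1] X * f 2 = 0 by rw [h, smul_zero]
  simp only [insDiff_eq_sum, Matrix.cons_val_zero, Matrix.cons_val_one, Matrix.cons_val_fin_one,
    pderivSmooth_mul, Finset.mul_sum, Finset.sum_mul, ← Finset.sum_sub_distrib,
    ← Finset.sum_add_distrib]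
  exact Finset.sum_eq_zero fun i _ => Finset.sum_eq_zero fun j _ => by ring

theorem hkr_mem_cocycleT (X : n.Bivector) : n.hkr X ∈ n.cocycleT :=
  ⟨n.hkr_mem_cochainT X, n.hochschildD_hkr X⟩

theorem hkr_swap (X : n.Bivector) (f g : n.Fun) : n.hkr X ![g, f] = -n.hkr X ![f, g] := by
  have h : n.insDiff ![g, f] = -n.insDiff ![f, g] := by
    refine n.linearMap_ext_wedge fun X Y => ?_
    simp [insDiff_wedge]
  simp [hkr_apply, h]

/-- The coefficients of `X` are the alternating part of `U(X) + δψ` on coordinates. -/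
theorem bivCoeff_eq_hkr_add_coboundary (X : n.Bivector) (ψ : HCochain n.Fun 1)
    (i j : Fin n.nT) :
    n.bivCoeff i j X = (n.hkr X + hochschildD n.Fun 1 ψ) ![coordFun i, coordFun j] -
      (n.hkr X + hochschildD n.Fun 1 ψ) ![coordFun j, coordFun i] := by
  rw [add_apply, add_apply, hochschildD_one_symm ψ (coordFun j), n.hkr_swap X (coordFun i)]
  have h : n.hkr X ![coordFun i, coordFun j] = (1 / 2 : ℝ) • n.bivCoeff i j X := n.hkr_apply _ _
  rw [h]
  module

theorem eq_zero_of_bivCoeff {X : n.Bivector} (h : ∀ i j, n.bivCoeff i j X = 0) : X = 0 := by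
  have h2 := n.two_smul_eq_sum_wedge X
  simp only [h, zero_smul, Finset.sum_const_zero] at h2
  have h3 : (algebraMap ℝ n.Fun (1 / 2) * 2) • X = 0 := by rw [mul_smul, h2, smul_zero]
  have h4 : algebraMap ℝ n.Fun (1 / 2) * 2 = 1 := by
    rw [← map_ofNat (algebraMap ℝ n.Fun) 2, ← map_mul]; norm_num
  rwa [h4, one_smul] at h3

/-! ### Constraint functions and vector fields -/

theorem mul_mem_fun0 (f : n.Fun) {g : n.Fun} (hg : g ∈ n.fun0) : f * g ∈ n.fun0 := fun x hx => by
  rw [SmoothFun.mul_apply, hg x hx, mul_zero]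

theorem mul_mem_fun0' {f : n.Fun} (hf : f ∈ n.fun0) (g : n.Fun) : f * g ∈ n.fun0 := by
  rw [mul_comm]; exact n.mul_mem_fun0 g hf

/-- The coordinate line in direction i through a point of C stays in C, where f vanishes. -/
theorem pderivSmooth_mem_fun0 {f : n.Fun} (hf : f ∈ n.fun0) {i : Fin n.nT}
    (hi : (i : ℕ) < n.nN) : pderivSmooth i f ∈ n.fun0 := fun x hx => by
  rw [pderivSmooth_apply, ← (f.differentiableAt x).lineDeriv_eq_fderiv, lineDeriv]
  have h : (fun t : ℝ => f (x + t • Pi.single i (1 : ℝ))) = fun _ => 0 := by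
    ext t
    refine hf _ fun j hj => ?_
    have hij : j ≠ i := fun h => by subst h; omega
    simp [hx j hj, hij]
  rw [h, deriv_const]

theorem mem_funN_iff {f : n.Fun} :
    f ∈ n.funN ↔ ∀ i : Fin n.nT, (i : ℕ) < n.n0 → pderivSmooth i f ∈ n.fun0 := Iff.rfl

theorem fun0_le_funN : n.fun0 ≤ n.funN := fun _ hf _ hi =>
  n.pderivSmooth_mem_fun0 hf (hi.trans_le n.le_N)

theorem mul_mem_funN {f g : n.Fun} (hf : f ∈ n.funN) (hg : g ∈ n.funN) : f * g ∈ n.funN :=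
  n.mem_funN_iff.2 fun i hi => by
    rw [pderivSmooth_mul]
    exact add_mem (n.mul_mem_fun0 _ (hg i hi)) (n.mul_mem_fun0' (hf i hi) _)

theorem pderivSmooth_mem_funN {f : n.Fun} (hf : f ∈ n.funN) {i : Fin n.nT}
    (hi : (i : ℕ) < n.nN) : pderivSmooth i f ∈ n.funN :=
  n.mem_funN_iff.2 fun j hj => by
    rw [← Module.End.mul_apply, (pderivSmooth_commute j i).eq]
    exact n.pderivSmooth_mem_fun0 (hf j hj) hi

/-- These coordinates are the admissible test functions for detecting the 0-component. -/
theorem coordFun_mem_funN {i : Fin n.nT} (hi : n.n0 ≤ (i : ℕ)) : coordFun i ∈ n.funN :=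
  n.mem_funN_iff.2 fun j hj => by
    rw [pderivSmooth_coordFun, if_neg (by rintro rfl; omega)]
    exact zero_mem _

/-- The action of a vector field on functions. -/
def vecApply (X : n.VecField) (f : n.Fun) : n.Fun := ∑ i, X i * pderivSmooth i f

theorem vecApply_mem_fun0_of_vec0 {X : n.VecField} (hX : X ∈ n.vec0) {f : n.Fun}
    (hf : f ∈ n.funN) : n.vecApply X f ∈ n.fun0 := sum_mem fun i _ => by
  rcases lt_or_ge (i : ℕ) n.n0 with hi | hi
  · exact n.mul_mem_fun0 _ (hf i hi)
  · exact n.mul_mem_fun0' (hX i hi) _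

theorem vecApply_mem_fun0 {X : n.VecField} (hX : X ∈ n.vecN) {f : n.Fun}
    (hf : f ∈ n.fun0) : n.vecApply X f ∈ n.fun0 := sum_mem fun i _ => by
  rcases lt_or_ge (i : ℕ) n.nN with hi | hi
  · exact n.mul_mem_fun0 _ (n.pderivSmooth_mem_fun0 hf hi)
  · exact n.mul_mem_fun0' (hX.1 i hi) _

/-- Termwise: along the distribution ∂_i f ∈ A_0; in the remaining tangent directions both factors
lie in A_N; in normal directions X^i ∈ A_0. -/
theorem vecApply_mem_funN {X : n.VecField} (hX : X ∈ n.vecN) {f : n.Fun}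
    (hf : f ∈ n.funN) : n.vecApply X f ∈ n.funN := sum_mem fun i _ => by
  rcases lt_or_ge (i : ℕ) n.nN with hi | hi
  · rcases lt_or_ge (i : ℕ) n.n0 with hi' | hi'
    · exact n.fun0_le_funN (n.mul_mem_fun0 _ (hf i hi'))
    · exact n.mul_mem_funN (hX.2 i hi' hi) (n.pderivSmooth_mem_funN hf hi)
  · exact n.fun0_le_funN (n.mul_mem_fun0' (hX.1 i hi) _)

theorem hkr_wedge_apply (X Y : n.VecField) (f : Fin 2 → n.Fun) :
    n.hkr (n.wedge X Y) f = (1 / 2 : ℝ) • (n.vecApply X (f 0) * n.vecApply Y (f 1) -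
      n.vecApply X (f 1) * n.vecApply Y (f 0)) := by
  rw [hkr_apply, insDiff_wedge]
  rfl

theorem mem_cochain0_of {k : ℕ} {φ : HCochain n.Fun k} (hT : φ ∈ n.cochainT k)
    (h : ∀ f : Fin k → n.Fun, (∀ i, f i ∈ n.funN) → φ f ∈ n.fun0) : φ ∈ n.cochain0 k :=
  ⟨⟨hT, fun f hf => n.fun0_le_funN (h f hf), fun f hf _ => h f hf⟩, h⟩

theorem hkr_mem_cochain0 {X : n.Bivector} (hX : X ∈ n.biv0) : n.hkr X ∈ n.cochain0 2 := by
  suffices h : n.biv0 ≤ (n.cochain0 2).comap n.hkrLin from h hX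
  rw [biv0, Submodule.span_le]
  rintro _ ⟨X, hX, Y, rfl⟩
  refine n.mem_cochain0_of (n.hkr_mem_cochainT _) fun f hf => ?_
  rw [hkrLin_apply, hkr_wedge_apply]
  exact Submodule.smul_mem _ _ (sub_mem
    (n.mul_mem_fun0' (n.vecApply_mem_fun0_of_vec0 hX (hf 0)) _)
    (n.mul_mem_fun0' (n.vecApply_mem_fun0_of_vec0 hX (hf 1)) _))

theorem hkr_mem_cochainN {X : n.Bivector} (hX : X ∈ n.bivN) : n.hkr X ∈ n.cochainN 2 := by
  suffices h : n.bivN ≤ (n.cochainN 2).comap n.hkrLin from h hX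
  refine sup_le ?_ fun X hX => (n.hkr_mem_cochain0 hX).1
  rw [Submodule.span_le]
  rintro _ ⟨X, hX, Y, hY, rfl⟩
  refine ⟨n.hkr_mem_cochainT _, fun f hf => ?_, fun f hf ⟨i, hi⟩ => ?_⟩
  · rw [hkrLin_apply, hkr_wedge_apply]
    exact Submodule.smul_mem _ _ (sub_mem
      (n.mul_mem_funN (n.vecApply_mem_funN hX (hf 0)) (n.vecApply_mem_funN hY (hf 1)))
      (n.mul_mem_funN (n.vecApply_mem_funN hX (hf 1)) (n.vecApply_mem_funN hY (hf 0))))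
  · rw [hkrLin_apply, hkr_wedge_apply]
    refine Submodule.smul_mem _ _ ?_
    fin_cases i
    · exact sub_mem (n.mul_mem_fun0' (n.vecApply_mem_fun0 hX hi) _)
        (n.mul_mem_fun0 _ (n.vecApply_mem_fun0 hY hi))
    · exact sub_mem (n.mul_mem_fun0 _ (n.vecApply_mem_fun0 hY hi))
        (n.mul_mem_fun0' (n.vecApply_mem_fun0 hX hi) _)

/-- A bivector field whose coefficients transversal to the distribution vanish on the
submanifold lies in the `0`-component. -/
theorem mem_biv0_of_bivCoeff {X : n.Bivector}
    (h : ∀ i j : Fin n.nT, n.n0 ≤ (i : ℕ) → n.n0 ≤ (j : ℕ) → n.bivCoeff i j X ∈ n.fun0) :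
    X ∈ n.biv0 := by
  have hw : ∀ Y ∈ n.vec0, ∀ Z, n.wedge Y Z ∈ n.biv0 := fun Y hY Z =>
    Submodule.subset_span ⟨Y, hY, Z, rfl⟩
  have hs : ∀ (c : n.Fun) (i : Fin n.nT), ((i : ℕ) < n.n0 ∨ c ∈ n.fun0) →
      c • (Pi.single i 1 : n.VecField) ∈ n.vec0 := fun c i hi j hj => by
    rw [Pi.smul_apply, smul_eq_mul]
    rcases eq_or_ne j i with rfl | hij
    · exact n.mul_mem_fun0' (hi.resolve_left (by omega)) _
    · rw [Pi.single_eq_of_ne hij, mul_zero]; exact zero_mem _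
  have h2 : (2 : n.Fun) • X ∈ n.biv0 := by
    rw [two_smul_eq_sum_wedge]
    refine sum_mem fun i _ => sum_mem fun j _ => ?_
    -- If i or j lies along the distribution, that factor absorbs the coefficient and is in V_0 for
    -- any coefficient; otherwise the coefficient itself is in A_0.
    by_cases hi : (i : ℕ) < n.n0
    · rw [← smul_wedge]
      exact hw _ (hs _ _ (Or.inl hi)) _
    by_cases hj : (j : ℕ) < n.n0
    · rw [n.wedge_swap, smul_neg, ← smul_wedge]
      exact neg_mem (hw _ (hs _ _ (Or.inl hj)) _)
    · rw [← smul_wedge]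
      exact hw _ (hs _ _ (Or.inr (h i j (not_lt.1 hi) (not_lt.1 hj)))) _
  -- `biv0` is a real subspace by definition, so the division by 2 uses a real scalar.
  have h3 : X = (1 / 2 : ℝ) • (2 : n.Fun) • X := by
    rw [two_smul, ← two_smul ℝ, smul_smul]; norm_num
  rw [h3]
  exact Submodule.smul_mem _ _ h2

/-! ### The symmetric part -/

/-- Multi-indices of the symmetric tensors `∂_{i_1} ∨ ⋯ ∨ ∂_{i_k} ∨ ∂_j` with `k ≥ 1`, the `i_l`
along the distribution, and `j` normal to the submanifold. -/
def extIndices : Set (Fin n.nT →₀ ℕ) :=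
  {μ | ∃ ν, ν ≠ 0 ∧ (∀ i : Fin n.nT, ν i ≠ 0 → (i : ℕ) < n.n0) ∧
    ∃ j : Fin n.nT, n.nN ≤ (j : ℕ) ∧ μ = ν + Finsupp.single j 1}

-- Supports of products lie in sums of supports, and the nonzero multi-indices along the
-- distribution are closed under addition, so every power with k ≥ 1 is covered. This reduces
-- statements about S to single monomials.
open scoped Pointwise in
theorem symExt_le_restrictSupport :
    n.symExt ≤ MvPolynomial.restrictSupport (SmoothFun n.nN) n.extIndices := by
  let s : Set (Fin n.nT →₀ ℕ) := {ν | ν ≠ 0 ∧ ∀ i : Fin n.nT, ν i ≠ 0 → (i : ℕ) < n.n0}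
  let t : Set (Fin n.nT →₀ ℕ) := {μ | ∃ j : Fin n.nT, n.nN ≤ (j : ℕ) ∧ μ = Finsupp.single j 1}
  have h0 : n.symTangent0 ≤ MvPolynomial.restrictSupport _ s := by
    rw [symTangent0, Submodule.span_le]
    rintro _ ⟨i, hi, rfl⟩
    refine (MvPolynomial.monomial_mem_restrictSupport _).2 (Or.inl ⟨by simp, fun j hj => ?_⟩)
    rcases eq_or_ne i j with rfl | hij
    · exact hi
    · simp [hij] at hj
  have h1 : n.symNormal ≤ MvPolynomial.restrictSupport _ t := by
    rw [symNormal, Submodule.span_le]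
    rintro _ ⟨i, hi, rfl⟩
    exact (MvPolynomial.monomial_mem_restrictSupport _).2 (Or.inl ⟨i, hi, rfl⟩)
  have hss : s + s ⊆ s := by
    rintro _ ⟨a, ha, b, hb, rfl⟩
    refine ⟨fun h => ha.1 ?_, fun i hi => ?_⟩
    · exact (add_eq_zero.1 h).1
    · by_cases hai : a i = 0
      · exact hb.2 i fun hbi => hi (by simp [hai, hbi])
      · exact ha.2 i hai
  have hpow : ∀ k : ℕ, n.symTangent0 ^ (k + 1) ≤ MvPolynomial.restrictSupport _ s := fun k => by
    induction k with
    | zero => simpa using h0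
    | succ k ih =>
      rw [pow_succ]
      refine (mul_le_mul' ih h0).trans ?_
      rw [← MvPolynomial.restrictSupport_add]
      exact MvPolynomial.restrictSupport_mono _ hss
  refine iSup_le fun k => (mul_le_mul' (hpow k) h1).trans ?_
  rw [← MvPolynomial.restrictSupport_add]
  refine MvPolynomial.restrictSupport_mono _ ?_
  rintro _ ⟨a, ha, _, ⟨j, hj, rfl⟩, rfl⟩
  exact ⟨a, ha.1, ha.2, j, hj, rfl⟩

/-- Operators which, up to functions vanishing on the submanifold, are derivations on the
`N`-component of the constraint algebra of functions. -/
def derivationsModFun0 : Submodule n.Fun (Module.End ℝ n.Fun) where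
  carrier := {φ | ∀ f ∈ n.funN, ∀ g ∈ n.funN, f * φ g - φ (f * g) + φ f * g ∈ n.fun0}
  zero_mem' f _ g _ := by simp
  add_mem' {φ ψ} hφ hψ f hf g hg := by
    convert add_mem (hφ f hf g hg) (hψ f hf g hg) using 1
    simp only [LinearMap.add_apply]
    ring
  smul_mem' c φ hφ f hf g hg := by
    convert n.mul_mem_fun0 c (hφ f hf g hg) using 1
    simp only [LinearMap.smul_apply, smul_eq_mul]
    ring

theorem pderivSmooth_mem_derivationsModFun0 (i : Fin n.nT) :
    pderivSmooth i ∈ n.derivationsModFun0 := fun f _ g _ => by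
  convert zero_mem n.fun0 using 1
  rw [pderivSmooth_mul]
  ring

/-- The defect of ∂_i φ is ∂_i of the defect of φ, which stays in A_0 as ∂_i is tangent to C, minus
∂_i f · φ g + φ f · ∂_i g, which is in A_0 because f, g ∈ A_N. -/
theorem pderivSmooth_mul_mem_derivationsModFun0 {i : Fin n.nT} (hi : (i : ℕ) < n.n0)
    {φ : Module.End ℝ n.Fun} (hφ : φ ∈ n.derivationsModFun0) :
    pderivSmooth i * φ ∈ n.derivationsModFun0 := fun f hf g hg => by
  convert sub_mem (n.pderivSmooth_mem_fun0 (hφ f hf g hg) (hi.trans_le n.le_N))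
    (add_mem (n.mul_mem_fun0' (hf i hi) (φ g)) (n.mul_mem_fun0 (φ f) (hg i hi))) using 1
  simp only [Module.End.mul_apply, map_add, map_sub, pderivSmooth_mul]
  ring

theorem pderivMulti_mem_derivationsModFun0 {μ : Fin n.nT →₀ ℕ} (hμ : μ ∈ n.extIndices) :
    pderivMulti μ ∈ n.derivationsModFun0 := by
  obtain ⟨ν, -, hν, j, -, rfl⟩ := hμ
  induction ν using multiIndex_induction with
  | zero =>
    rw [zero_add, pderivMulti_single]
    exact n.pderivSmooth_mem_derivationsModFun0 j
  | add i α ih =>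
    rw [add_assoc, pderivMulti_add, pderivMulti_single]
    refine n.pderivSmooth_mul_mem_derivationsModFun0 (hν i (by simp)) (ih fun k hk => hν k ?_)
    simp [hk]

theorem Op_prol_apply (D : n.SymTensorSub) :
    n.Op (n.prol D) = ∑ μ ∈ D.support, n.prolFun (D.coeff μ) • pderivMulti μ := by
  rw [Op_apply]
  refine Finset.sum_subset (MvPolynomial.support_map_subset _ _) (fun μ _ hμ => ?_) |>.trans ?_
  · exact smul_eq_zero_of_left (MvPolynomial.notMem_support_iff.1 hμ) _
  · refine Finset.sum_congr rfl fun μ _ => ?_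
    rw [prol, MvPolynomial.coeff_map]
    rfl

/-- On a pair (f, g), the coboundary is precisely the defect of `Op (prol D)` from being a
derivation. -/
theorem hochschildD_Op_prol_mem_cochain0 {D : n.SymTensorSub} (hD : D ∈ n.symExt) :
    hochschildD n.Fun 1 (HCochain.ofEnd (n.Op (n.prol D))) ∈ n.cochain0 2 := by
  refine n.mem_cochain0_of (n.hochschildD_Op_mem_cochainT _) fun f hf => ?_
  have h : n.Op (n.prol D) ∈ n.derivationsModFun0 := by
    rw [Op_prol_apply]
    exact sum_mem fun μ hμ => Submodule.smul_mem _ _ <|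
      n.pderivMulti_mem_derivationsModFun0 (n.symExt_le_restrictSupport hD hμ)
  rw [hochschildD_one_apply]
  exact h _ (hf 0) _ (hf 1)

theorem hkrExt_mem_cocycleN {X : n.Bivector} (hX : X ∈ n.bivN) {D : n.SymTensorSub}
    (hD : D ∈ n.symExt) : n.hkrExt X D ∈ n.cocycleN := by
  refine ⟨add_mem (n.hkr_mem_cochainN hX) (n.hochschildD_Op_prol_mem_cochain0 hD).1, ?_⟩
  change hochschildD n.Fun 2 _ = 0
  rw [hkrExt, map_add, hochschildD_hkr, hochschildD_two_hochschildD_one,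
    add_zero]

theorem hkrExt_mem_cocycle0 {X : n.Bivector} (hX : X ∈ n.biv0) {D : n.SymTensorSub}
    (hD : D ∈ n.symExt) : n.hkrExt X D ∈ n.cocycle0 :=
  ⟨add_mem (n.hkr_mem_cochain0 hX) (n.hochschildD_Op_prol_mem_cochain0 hD),
    (n.hkrExt_mem_cocycleN (n.biv0_le_bivN hX) hD).2⟩

/-- If `Op (prol D)` agrees up to a derivation with a constraint operator, then `D = 0`. -/
theorem eq_zero_of_hochschildD_eq {D : n.SymTensorSub} (hD : D ∈ n.symExt)
    {ψ : HCochain n.Fun 1} (hψ : ψ ∈ n.cochainN 1)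
    (h : hochschildD n.Fun 1 (HCochain.ofEnd (n.Op (n.prol D))) = hochschildD n.Fun 1 ψ) :
    D = 0 := by
  by_contra hne
  obtain ⟨μ, hμ⟩ := MvPolynomial.support_nonempty.2 hne
  obtain ⟨ν, hν0, -, j, hj, hμν⟩ := n.symExt_le_restrictSupport hD hμ
  refine MvPolynomial.mem_support_iff.1 hμ (SmoothFun.ext fun q => ?_)
  -- The point q of C, padded with zeros in the normal coordinates.
  let p : Fin n.nT → ℝ := fun i => if hi : (i : ℕ) < n.nN then q ⟨i, hi⟩ else 0
  have hp : p ∈ n.sub := fun i hi => dif_neg (by omega)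
  -- F = (x-p)^ν vanishes at p because ν ≠ 0. F need not lie in A_N: only FG is fed to the
  -- constraint property of ψ.
  let F : n.Fun := polyFun p (MvPolynomial.monomial ν 1)
  let G : n.Fun := coordFun j
  have hGp : ∀ x ∈ n.sub, G x = 0 := fun x hx => hx j hj
  have hFp : F p = 0 := by
    simp only [F]
    rw [polyFun_apply_self, MvPolynomial.constantCoeff_monomial, if_neg hν0]
  have hFG : F * G = polyFun p (MvPolynomial.monomial μ 1) := by
    have hX : (MvPolynomial.monomial μ (1 : ℝ)) =
        MvPolynomial.monomial ν 1 * MvPolynomial.X j := by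
      rw [hμν, MvPolynomial.X, MvPolynomial.monomial_mul, one_mul]
    rw [hX, map_mul, polyFun_X, hp j hj, map_zero, sub_zero]
  have hFG0 : F * G ∈ n.fun0 := n.mul_mem_fun0 _ hGp
  have hψ0 : ψ ![F * G] p = 0 :=
    hψ.2.2 _ (fun i => by fin_cases i; exact n.fun0_le_funN hFG0)
      ⟨0, hFG0⟩ p hp
  -- At p the outer terms of both coboundaries vanish with F and G, and ψ(FG) vanishes too, leaving
  -- Op(prol D)(FG)(p) = 0.
  have h1 := congrArg (fun χ : HCochain n.Fun 2 => χ ![F, G] p) h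
  simp only [hochschildD_one_apply, Matrix.cons_val_zero, Matrix.cons_val_one,
    Matrix.cons_val_fin_one, SmoothFun.add_apply, SmoothFun.sub_apply, SmoothFun.mul_apply,
    hFp, hGp p hp, zero_mul, mul_zero, add_zero, hψ0, sub_zero, zero_sub, neg_eq_zero,
    HCochain.ofEnd_apply] at h1
  have hsum : n.Op (n.prol D) (F * G) p =
      ∑ μ' ∈ D.support, D.coeff μ' q * pderivMulti μ' (F * G) p := by
    have hq : (fun i => p (Fin.castLE n.le_T i)) = q := by
      ext i
      simp [p]
    have hpq : ∀ c, n.prolFun c p = c q := fun c => congrArg c hq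
    let ev : n.Fun →+ ℝ :=
      { toFun := fun f => f p, map_zero' := rfl, map_add' := fun _ _ => rfl }
    rw [Op_prol_apply, LinearMap.sum_apply]
    refine (map_sum ev _ _).trans (Finset.sum_congr rfl fun μ' _ => ?_)
    change (n.prolFun (D.coeff μ') * pderivMulti μ' (F * G)) p = _
    rw [SmoothFun.mul_apply, hpq]
  have hne := fun μ' => pderivMulti_polyFun_monomial_apply_self p μ' μ 1 one_ne_zero
  -- FG = (x-p)^μ, so among the derivatives at p only ∂^μ contributes.
  rw [hsum, hFG, Finset.sum_eq_single_of_mem μ hμ fun μ' _ hμ' => by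
    rw [not_not.1 (mt (hne μ').1 hμ'), mul_zero]] at h1
  exact (mul_eq_zero.1 h1).resolve_right ((hne μ).2 rfl)

/-! ### The extended HKR map -/

theorem prol_smul (c : ℝ) (D : n.SymTensorSub) : n.prol (c • D) = c • n.prol D := by
  ext1 μ
  simp only [prol, MvPolynomial.coeff_map, MvPolynomial.coeff_smul]
  exact map_smul n.prolFun c (MvPolynomial.coeff μ D)

/-- The extended HKR map on representatives of the `N`-component. -/
def hkrExtLin : n.bivN × n.symExt →ₗ[ℝ] n.cocycleN where
  toFun Y := ⟨n.hkrExt Y.1 Y.2, n.hkrExt_mem_cocycleN Y.1.2 Y.2.2⟩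
  map_add' Y Z := by
    refine Subtype.ext (MultilinearMap.ext fun f => ?_)
    have h := congrArg (· f) (n.hkrLin.map_add Y.1 Z.1)
    simp only [hkrLin_apply, add_apply] at h
    simp only [hkrExt, hochschildD_one_apply, add_apply, HCochain.ofEnd_apply, Prod.fst_add,
      Prod.snd_add, Submodule.coe_add, map_add, LinearMap.add_apply, h]
    ring
  map_smul' c Y := by
    refine Subtype.ext (MultilinearMap.ext fun f => ?_)
    have h := congrArg (· f) (n.hkrLin.map_smul c Y.1)
    simp only [hkrLin_apply, smul_apply] at h
    have hO : n.Op (n.prol ((c • Y).2 : n.symExt)) = c • n.Op (n.prol Y.2) :=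
      (congrArg n.Op (n.prol_smul c Y.2)).trans (LinearMap.map_smul_of_tower _ _ _)
    simp only [hkrExt, hochschildD_one_apply, add_apply, HCochain.ofEnd_apply, Prod.smul_fst,
      Submodule.coe_smul, hO, LinearMap.smul_apply, smul_apply, h, RingHom.id_apply, smul_add,
      smul_sub, mul_smul_comm, smul_mul_assoc]

theorem classT_eq_zero_iff (φ : n.cocycleT) : n.classT φ = 0 ↔ (φ : HCochain n.Fun 2) ∈
    n.coboundaryT :=
  Submodule.Quotient.mk_eq_zero _

theorem classN_eq_zero_iff (φ : n.cocycleN) : n.classN φ = 0 ↔ (φ : HCochain n.Fun 2) ∈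
    n.coboundaryN :=
  Submodule.Quotient.mk_eq_zero _

theorem classN_mem_zero_iff (φ : n.cocycleN) : n.classN φ ∈ n.HH2.zero ↔
    ∃ φ₀ ∈ n.cocycle0, (φ : HCochain n.Fun 2) - φ₀ ∈ n.coboundaryN :=
  (ConModule.mkQ_mem_map_mkQ_iff _ _ φ).trans
    ⟨fun ⟨φ₀, h0, h⟩ => ⟨φ₀, h0, h⟩, fun ⟨φ₀, h0, h⟩ => ⟨⟨φ₀, h0.1.1, h0.2⟩, h0, h⟩⟩

/-- The extended constraint HKR map. -/
def extHKR : n.extBivector ⟶ n.HH2 where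
  T := ConModule.subquotient.mkT _ _ _ _ _ _ _ ∘ₗ
    n.hkrLin.codRestrict n.cocycleT n.hkr_mem_cocycleT
  N := ConModule.subquotient.mkN _ _ _ _ _ _ _ ∘ₗ n.hkrExtLin
  comm := fun Y => by
    refine (Submodule.Quotient.eq _).2 ?_
    -- The difference is -δ(Op(prol D)), exact in the T-component since Op(prol D) is a differential
    -- operator.
    change n.hkr Y.1 - n.hkrExt Y.1 Y.2 ∈ n.coboundaryT
    rw [hkrExt, sub_add_cancel_left, ← map_neg]
    exact ⟨_, neg_mem (n.ofEnd_Op_mem_cochainT _), rfl⟩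
  map_zero_comp := fun Y hY =>
    (n.classN_mem_zero_iff _).2 ⟨_, n.hkrExt_mem_cocycle0 hY.1 Y.2.2, by
      convert zero_mem n.coboundaryN using 1
      exact sub_self (n.hkrExt Y.1 Y.2)⟩

theorem extHKR_T_injective : Function.Injective n.extHKR.T := by
  refine (injective_iff_map_eq_zero _).2 fun X hX => ?_
  obtain ⟨ψ, -, h⟩ := (n.classT_eq_zero_iff ⟨n.hkr X, n.hkr_mem_cocycleT X⟩).1 hX
  refine n.eq_zero_of_bivCoeff fun i j => ?_
  have h0 : n.hkr X + hochschildD n.Fun 1 (-ψ) = 0 := by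
    rw [map_neg, h, add_neg_cancel]
  rw [n.bivCoeff_eq_hkr_add_coboundary X (-ψ), h0]
  simp

/-- Compatibility with ι and injectivity in the T-component give X = 0; the rest concerns D alone.
-/
theorem extHKR_N_injective : Function.Injective n.extHKR.N := by
  refine (injective_iff_map_eq_zero _).2 fun Y hY => ?_
  have hX : (Y.1 : n.Bivector) = 0 := by
    refine n.extHKR_T_injective ((n.extHKR.comm Y).trans ?_)
    rw [hY, map_zero]
    exact (map_zero n.extHKR.T).symm
  obtain ⟨ψ, hψ, h⟩ := (n.classN_eq_zero_iff (n.hkrExtLin Y)).1 hY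
  refine Prod.ext (Subtype.ext hX) (Subtype.ext (n.eq_zero_of_hochschildD_eq Y.2.2 hψ ?_))
  rw [h]
  change _ = n.hkr Y.1 + _
  rw [hX, ← hkrLin_apply, map_zero, zero_add]

/-- If U(X) + δ(Op(prol D)) - δψ = φ with φ a 0-cocycle, alternating φ on coordinates in A_N gives
the transversal coefficients of X, so these lie in A_0. -/
theorem comap_extHKR_N_zero : n.HH2.zero.comap n.extHKR.N = n.extBivector.zero := by
  refine le_antisymm (fun Y hY => ⟨?_, Submodule.mem_top⟩) fun Y hY =>
    n.extHKR.map_zero_comp Y hY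
  obtain ⟨φ, hφ, ψ, -, h⟩ := (n.classN_mem_zero_iff (n.hkrExtLin Y)).1 hY
  have h0 : n.hkr Y.1 +
      hochschildD n.Fun 1 (HCochain.ofEnd (n.Op (n.prol Y.2)) - ψ) = φ := by
    rw [map_sub, h, ← add_sub_assoc]
    exact sub_sub_cancel _ _
  refine n.mem_biv0_of_bivCoeff fun i j hi hj => ?_
  change n.bivCoeff i j Y.1.1 ∈ n.fun0
  rw [n.bivCoeff_eq_hkr_add_coboundary _ (HCochain.ofEnd (n.Op (n.prol Y.2)) - ψ), h0]
  refine sub_mem (hφ.1.2 _ fun k => ?_) (hφ.1.2 _ fun k => ?_)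
  all_goals fin_cases k
  exacts [n.coordFun_mem_funN hi, n.coordFun_mem_funN hj, n.coordFun_mem_funN hj,
    n.coordFun_mem_funN hi]

end ConDim
end

theorem mainTheorem2 (n : ConDim) :
    ∃ U : n.extBivector ⟶ n.HH2,
      (∀ X : n.Bivector, ∃ h : n.hkr X ∈ n.cocycleT, U.T X = n.classT ⟨n.hkr X, h⟩) ∧
      (∀ (X : n.bivN) (D : n.symExt), ∃ h : n.hkrExt X D ∈ n.cocycleN,
        U.N (X, D) = n.classN ⟨n.hkrExt X D, h⟩) ∧
      IsRegularMono U ∧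
      Function.Injective U.T ∧ Function.Injective U.N ∧
      n.HH2.zero.comap U.N = n.extBivector.zero :=
  ⟨n.extHKR, fun X => ⟨n.hkr_mem_cocycleT X, rfl⟩,
    fun X D => ⟨n.hkrExt_mem_cocycleN X.2 D.2, rfl⟩,
    ConModule.isRegularMono_of_injective _ n.extHKR_T_injective n.extHKR_N_injective
      n.comap_extHKR_N_zero,
    n.extHKR_T_injective, n.extHKR_N_injective, n.comap_extHKR_N_zero⟩
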